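/- **Generalized Laplace Analysis.** Let $F$ be a complex Hausdorff locally convex space that is separable and locally sequentially weakly compact (every bounded sequence has a weakly convergent subsequence), and let $L(F)$ be the space of continuous linear operators on $F$. Let $(S,\Sigma)$ be a measurable space and $m:\Sigma\to L(F)$ an equicontinuous spectral measure: $m$ is countably additive in the weak operator topology, $m(S)=I$, $m(A\cap B)=m(A)m(B)$, and $\{m(A):A\in\Sigma\}$ is equicontinuous. Let $f:S\to\mathbb C$ be bounded and measurable, let $U=\int_S f\,dm\in L(F)$ (the pointwise limit of the integrals of simple functions converging uniformly to $f$), and put $E(B)=m(f^{-1}(B))$ for Borel sets $B\subseteq\mathbb C$. Let $\sigma(U)$ be the complement of the set of $\xi\in\mathbb C$ for which $\xi I-U$ is injective with dense image and has a continuous inverse on its image, and let $\sigma_p(U)$ be the set of $\xi\in\sigma(U)$ for which $\xi I-U$ is not injective. With $D_r=\{|z|<r\}$, assume that $U$ has dominating point spectrum with radius $R>0$, that is: $\sigma(U)\setminus D_R\neq\emptyset$, and for every $r>R$, 1. if $\sigma(U)\cap D_r$ contains an eigenvalue, then some $\xi\in\sigma(U)\cap D_r$ satisfies $|\xi|=\sup\{|z|:z\in\sigma(U)\cap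 D_r\}$; 2. $\sigma(U)\setminus D_r\subseteq\sigma_p(U)$. Assume also that the point spectrum is concentrated on isolated circles: every point of $\{|f(s)|: s\in S,\ f(s)I-U\text{ is not injective}\}$ is an isolated point of this set. Let $\lambda\in\sigma_p(U)$ with $|\lambda|\ge R$, let $\Omega=\{\mu\in\sigma_p(U):|\mu|>|\lambda|\}$, and write $P_\mu=E(\{\mu\})$. For $T\in L(F)$ let $A_n(T)=n^{-1}\sum_{k=0}^{n-1}T^k$. Then: * The image of $P_\lambda$ is the eigenspace $N(\lambda I-U)$. * The sum $\sum_{\mu\in\Omega}P_\mu$ converges unconditionally in the strong operator topology to an operator in $L(F)$, and, in the strong operator topology, $$P_\lambda=\lim_{n\to\infty}A_n\Big(\lambda^{-1}U\big(I-\sum_{\mu\in\Omega}P_\mu\big)\Big)=\lim_{n\to\infty}\frac1n\sum_{k=1}^{n-1}\lambda^{-k}U^k\Big(I-\sum_{\mu\in\Omega}P_\mu\Big).$$ * If $\Omega$ is finite, then for every $\psi\in F$ the vector $P_\lambda\psi$ is obtained by a finite recursion: for every enumeration $\Omega=\{\nu_1,\dots,\nu_N\}$ without repetition with $|\nu_1|\ge\dots\ge|\nu_N|$,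 put $\rho_0=\psi$ and, successively for $j=1,\dots,N$, $\varphi_j=\lim_{n}A_n(\nu_j^{-1}U)\rho_{j-1}$ and $\rho_j=\rho_{j-1}-\varphi_j$. All these limits exist, $\varphi_j=P_{\nu_j}\psi$, and $\lim_{n}A_n(\lambda^{-1}U)\rho_N=P_\lambda\psi$. -/

import Mathlib

open Filter Topology

/-- A topological vector space is locally sequentially weakly compact if every bounded sequence
has a subsequence which converges weakly to an element of the space. -/
def LocallySeqWeaklyCompact (F : Type*) [AddCommGroup F] [Module ℂ F] [TopologicalSpace F] :
    Prop :=
  ∀ u : ℕ → F, Bornology.IsVonNBounded ℂ (Set.range u) →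
    ∃ (x : F) (φ : ℕ → ℕ), StrictMono φ ∧
      ∀ y : F →L[ℂ] ℂ, Tendsto (fun n => y (u (φ n))) atTop (𝓝 (y x))

section Operators

variable {F : Type*} [AddCommGroup F] [Module ℂ F] [TopologicalSpace F]
  [IsTopologicalAddGroup F] [ContinuousSMul ℂ F]

/-- A spectral measure on the measurable space `S` with values in the continuous operators on `F`:
it is countably additive in the weak operator topology, sends `S` to the identity and intersections
to products. Only its values on measurable sets are meaningful. -/
structure OperatorSpectralMeasure (S : Type*) [MeasurableSpace S] (F : Type*) [AddCommGroup F]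
    [Module ℂ F] [TopologicalSpace F] [IsTopologicalAddGroup F] [ContinuousSMul ℂ F] where
  toFun : Set S → F →L[ℂ] F
  univ_eq_one : toFun Set.univ = 1
  inter_eq_mul : ∀ A B : Set S, MeasurableSet A → MeasurableSet B →
    toFun (A ∩ B) = toFun A * toFun B
  hasSum_iUnion : ∀ A : ℕ → Set S, (∀ i, MeasurableSet (A i)) →
    Pairwise (fun i j => Disjoint (A i) (A j)) → ∀ (x : F) (y : F →L[ℂ] ℂ),
      HasSum (fun i => y (toFun (A i) x)) (y (toFun (⋃ i, A i) x))

/-- The values of the spectral measure on measurable sets form an equicontinuous family. -/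
def OperatorSpectralMeasure.IsEquicontinuous {S : Type*} [MeasurableSpace S]
    (m : OperatorSpectralMeasure S F) : Prop :=
  ∀ p : Seminorm ℂ F, Continuous p → ∃ q : Seminorm ℂ F, Continuous q ∧
    ∀ A : Set S, MeasurableSet A → ∀ x : F, p (m.toFun A x) ≤ q x

/-- The integral of a simple function against a spectral measure. -/
noncomputable def OperatorSpectralMeasure.simpleIntegral {S : Type*} [MeasurableSpace S]
    (m : OperatorSpectralMeasure S F) (g : MeasureTheory.SimpleFunc S ℂ) : F →L[ℂ] F :=
  ∑ c ∈ g.range, c • m.toFun (g ⁻¹' {c})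

/-- `U = ∫ f dm`: the operator `U` is the pointwise limit of the integrals of a sequence of simple
functions that converges uniformly to `f`. -/
def OperatorSpectralMeasure.HasIntegral {S : Type*} [MeasurableSpace S]
    (m : OperatorSpectralMeasure S F) (f : S → ℂ) (U : F →L[ℂ] F) : Prop :=
  ∃ g : ℕ → MeasureTheory.SimpleFunc S ℂ,
    TendstoUniformly (fun n s => g n s) f atTop ∧
      ∀ x : F, Tendsto (fun n => m.simpleIntegral (g n) x) atTop (𝓝 (U x))

/-- The spectral measure on `ℂ` obtained from `m` by the change of variables `f`, that is
`E(B) = m(f⁻¹(B))`. -/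
def OperatorSpectralMeasure.resolution {S : Type*} [MeasurableSpace S]
    (m : OperatorSpectralMeasure S F) (f : S → ℂ) (B : Set ℂ) : F →L[ℂ] F :=
  m.toFun (f ⁻¹' B)

/-- The resolvent set: those `ξ` for which the image of `ξ I - U` is dense and `ξ I - U` has a
continuous inverse defined on its image (so `ξ I - U` is a topological embedding). -/
def opResolventSet (U : F →L[ℂ] F) : Set ℂ :=
  {ξ | DenseRange (ξ • (1 : F →L[ℂ] F) - U) ∧ IsEmbedding (ξ • (1 : F →L[ℂ] F) - U)}

/-- The spectrum `σ(U)`. -/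
def opSpectrum (U : F →L[ℂ] F) : Set ℂ := (opResolventSet U)ᶜ

/-- The point spectrum `σ_p(U)`. -/
def opPointSpectrum (U : F →L[ℂ] F) : Set ℂ :=
  {ξ ∈ opSpectrum U | ¬ Function.Injective (ξ • (1 : F →L[ℂ] F) - U)}

/-- The elements of `A` whose modulus is the supremum of the moduli of the elements of `A`. -/
def peripheralPart (A : Set ℂ) : Set ℂ := {ξ ∈ A | IsLUB ((fun z : ℂ => ‖z‖) '' A) ‖ξ‖}

/-- `R` witnesses that `U` has dominating point spectrum. -/
structure IsDominatingRadius (U : F →L[ℂ] F) (R : ℝ) : Prop where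
  pos : 0 < R
  nonempty : (opSpectrum U \ Metric.ball 0 R).Nonempty
  peripheral : ∀ r : ℝ, R < r →
    ((opSpectrum U ∩ Metric.ball 0 r) ∩ opPointSpectrum U).Nonempty →
      (peripheralPart (opSpectrum U ∩ Metric.ball 0 r)).Nonempty
  eigenvalues : ∀ r : ℝ, R < r → opSpectrum U \ Metric.ball 0 r ⊆ opPointSpectrum U

/-- The moduli of those values of `f` that are eigenvalues of `U`. -/
def pointSpectrumRadii {S : Type*} (f : S → ℂ) (U : F →L[ℂ] F) : Set ℝ :=
  {r | ∃ s : S, ‖f s‖ = r ∧ ¬ Function.Injective (f s • (1 : F →L[ℂ] F) - U)}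

/-- The point spectrum of `U = ∫ f dm` is concentrated on isolated circles. -/
def PointSpectrumOnIsolatedCircles {S : Type*} (f : S → ℂ) (U : F →L[ℂ] F) : Prop :=
  ∀ r ∈ pointSpectrumRadii f U, ∃ ε > 0, ∀ r' ∈ pointSpectrumRadii f U, |r' - r| < ε → r' = r

/-- The averages `A_n(T) = n⁻¹ ∑_{k=0}^{n-1} T^k`. -/
noncomputable def opAverage (n : ℕ) (T : F →L[ℂ] F) : F →L[ℂ] F :=
  (n : ℂ)⁻¹ • ∑ k ∈ Finset.range n, T ^ k

/-- The eigenvalues of `U` of modulus larger than that of `lam`. -/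
def largerEigenvalues (U : F →L[ℂ] F) (lam : ℂ) : Set ℂ :=
  {ν ∈ opPointSpectrum U | ‖lam‖ < ‖ν‖}

end Operators

/-!
Off `{f = ξ}` the function `(ξ - f)⁻¹` is bounded on each set `{|ξ - f| ≥ δ}`, so `ξ - U` has
approximate inverses there. Hence `m {f = ξ}` projects onto the eigenspace of `ξ`, and the range of
`1 - m {f = ξ}` lies in the closure of the range of `ξ - U`. For the integral `T` of a function of
modulus at most `1` this is, with `ξ = 1`, the splitting of the mean ergodic theorem, and the
averages of `T` converge to the spectral projection of `{1}`. With `Q = E {|z| > |lam|}`, the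
operator `lam⁻¹ U (1 - Q)` is the integral of such a function, which equals `1` exactly on
`{f = lam}`.

It remains to see that `E` is purely atomic on a Borel set `B` in which every spectral value is an
eigenvalue. Let `ν` be a positive measure dominated by a scalar measure `y (E (· ∩ B) x)` that has
no atoms at the eigenvalues.

* `ν` vanishes off the spectrum: near a point `ξ` where `ξ - U` is boundedly invertible,
  `E` of a ball of radius `r` decays faster than every power of `r`, hence faster than area, which
  by Besicovitch differentiation can happen only on a `ν`-null set.
* `ν` vanishes on the eigenvalues: being nonatomic, it carries a function `G` that is uniformly
  distributed on `[0, 1]`, and by the Riemann–Lebesgue lemma every subsequence of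
  `exp (-2πi n G)` diverges `ν`-almost everywhere. Sequential weak compactness gives, for each `x`,
  a subsequence of `∫ exp (-2πi n G(f)) dm x` that converges weakly, so that `exp (-2πi n G)`
  converges along it at all `z` with `E {z} x ≠ 0`. By separability `E {z} = 0` for `ν`-almost
  every `z`.

So `Q` is the sum of the eigenprojections, and since `E` vanishes off the eigenvalues in
`{|z| > |lam|}`, removing them one by one brings any vector into the kernel of `Q`.
-/

section LocallyConvex

variable {F : Type*} [AddCommGroup F] [Module ℂ F] [TopologicalSpace F] [IsTopologicalAddGroup F]

theorem tendsto_nhds_iff_forall_seminorm [PolynormableSpace ℂ F] {ι : Type*} {l : Filter ι}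
    {u : ι → F} {x : F} :
    Tendsto u l (𝓝 x) ↔
      ∀ p : Seminorm ℂ F, Continuous p → Tendsto (fun i => p (u i - x)) l (𝓝 0) := by
  refine ⟨fun h p hp => ?_, fun h => ?_⟩
  · simpa [Function.comp_def] using (hp.tendsto (x - x)).comp (h.sub_const x)
  · rw [(PolynormableSpace.withSeminorms ℂ F).tendsto_nhds]
    rintro ⟨p, hp⟩ ε hε
    exact (h p hp).eventually (gt_mem_nhds hε)

theorem exists_seminorm_sub_lt_of_mem_closure {A : Set F} {x : F}
    (hx : x ∈ closure A) {p : Seminorm ℂ F} (hp : Continuous p) {ε : ℝ} (hε : 0 < ε) :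
    ∃ v ∈ A, p (x - v) < ε := by
  have ho : IsOpen {v | p (x - v) < ε} :=
    isOpen_lt (hp.comp (continuous_const.sub continuous_id)) continuous_const
  obtain ⟨v, hv, hvA⟩ := mem_closure_iff.1 hx _ ho (by simpa using hε)
  exact ⟨v, hvA, hv⟩

variable [ContinuousSMul ℂ F] [PolynormableSpace ℂ F]

theorem mem_closure_of_forall_dual {N : Submodule ℂ F} {x : F}
    (h : ∀ y : F →L[ℂ] ℂ, (∀ v ∈ N, y v = 0) → y x = 0) : x ∈ closure (N : Set F) := by
  have := (PolynormableSpace.withSeminorms ℂ F).toLocallyConvexSpace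
  by_contra hx
  obtain ⟨y, u, hy, hu⟩ := RCLike.geometric_hahn_banach_closed_point (𝕜 := ℂ)
    (s := (N.topologicalClosure : Set F)) (N.topologicalClosure.restrictScalars ℝ).convex
    N.isClosed_topologicalClosure hx
  have hu0 : 0 < u := by simpa using hy 0 N.topologicalClosure.zero_mem
  have hyN : ∀ v ∈ N, y v = 0 := by
    intro v hv
    by_contra hne
    simpa [hne] using hy _ (N.le_topologicalClosure (N.smul_mem ((u : ℂ) / y v) hv))
  rw [h y hyN, map_zero] at hu
  exact hu.not_gt hu0

theorem mem_closure_of_tendsto_dual {N : Submodule ℂ F} {u : ℕ → F} {x : F} (hu : ∀ n, u n ∈ N)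
    (h : ∀ y : F →L[ℂ] ℂ, Tendsto (fun n => y (u n)) atTop (𝓝 (y x))) : x ∈ closure (N : Set F) :=
  mem_closure_of_forall_dual fun y hy =>
    tendsto_nhds_unique (h y) (by simp [fun n => hy _ (hu n)])

theorem eq_zero_of_forall_dual [T2Space F] {x : F} (h : ∀ y : F →L[ℂ] ℂ, y x = 0) : x = 0 := by
  simpa using mem_closure_of_forall_dual (N := ⊥) fun y _ => h y

theorem eq_of_forall_dual [T2Space F] {x x' : F} (h : ∀ y : F →L[ℂ] ℂ, y x = y x') : x = x' :=
  sub_eq_zero.1 (eq_zero_of_forall_dual fun y => by simp [h y])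

end LocallyConvex

section SubsetSums

open scoped Pointwise

variable {E ι : Type*} [AddCommGroup E]

theorem sum_smul_mem_of_forall_subset_sum_mem [Module ℝ E] {C : Set E} (hC : Convex ℝ C)
    {s : Finset ι} {v : ι → E} (h : ∀ t ⊆ s, ∑ i ∈ t, v i ∈ C) {c : ι → ℝ}
    (hc : ∀ i ∈ s, c i ∈ Set.Icc 0 1) : ∑ i ∈ s, c i • v i ∈ C := by
  classical
  have hsub : ∑ i ∈ s, ({0, v i} : Set E) ⊆ C := by
    intro a ha
    obtain ⟨w, hw, rfl⟩ := (Set.mem_finsetSum _ _ _).1 ha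
    convert h (s.filter fun i => w i ≠ 0) (s.filter_subset _) using 1
    rw [← Finset.sum_filter_ne_zero]
    refine Finset.sum_congr rfl fun i hi => ?_
    obtain ⟨his, hi0⟩ := Finset.mem_filter.1 hi
    exact (hw his).resolve_left hi0
  refine convexHull_min hsub hC ?_
  rw [convexHull_sum, Set.mem_finsetSum]
  refine ⟨fun i => c i • v i, fun {i} hi => ?_, rfl⟩
  rw [convexHull_pair, segment_eq_image']
  exact ⟨c i, hc i hi, by simp⟩

variable [Module ℂ E]

theorem seminorm_sum_smul_le (p : Seminorm ℂ E) {s : Finset ι} {v : ι → E} {M : ℝ}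
    (h : ∀ t ⊆ s, p (∑ i ∈ t, v i) ≤ M) {c : ι → ℂ} (hc : ∀ i ∈ s, ‖c i‖ ≤ 1) :
    p (∑ i ∈ s, c i • v i) ≤ 6 * M := by
  -- `c = 2a + 2ib - (1 + i)` with `a = (1 + re c) / 2` and `b = (1 + im c) / 2` in `[0, 1]`.
  have hsum : ∀ r : ι → ℝ, (∀ i ∈ s, |r i| ≤ 1) →
      p (∑ i ∈ s, (((1 + r i) / 2 : ℝ) : ℂ) • v i) ≤ M := fun r hr => by
    have := sum_smul_mem_of_forall_subset_sum_mem (p.convex_closedBall 0 M) (v := v) (s := s)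
      (by simpa using h) (c := fun i => (1 + r i) / 2) fun i hi => by
        have hri := abs_le.1 (hr i hi)
        constructor <;> linarith [hri.1, hri.2]
    simpa only [Complex.coe_smul, Seminorm.mem_closedBall_zero] using this
  have hre := hsum (fun i => (c i).re) fun i hi => (Complex.abs_re_le_norm _).trans (hc i hi)
  have him := hsum (fun i => (c i).im) fun i hi => (Complex.abs_im_le_norm _).trans (hc i hi)
  set a := ∑ i ∈ s, (((1 + (c i).re) / 2 : ℝ) : ℂ) • v i
  set b := ∑ i ∈ s, (((1 + (c i).im) / 2 : ℝ) : ℂ) • v i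
  set w := ∑ i ∈ s, v i
  have hdecomp : ∑ i ∈ s, c i • v i = (2 : ℂ) • a + (2 * Complex.I) • b - (1 + Complex.I) • w := by
    simp only [a, b, w, Finset.smul_sum, ← Finset.sum_add_distrib, ← Finset.sum_sub_distrib,
      smul_smul, ← add_smul, ← sub_smul]
    refine Finset.sum_congr rfl fun i _ => ?_
    congr 1
    conv_lhs => rw [← Complex.re_add_im (c i)]
    push_cast
    ring
  have hI : ‖1 + Complex.I‖ ≤ 2 := (norm_add_le _ _).trans (by norm_num)
  have hw := h s subset_rfl
  calc p (∑ i ∈ s, c i • v i)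
      ≤ ‖(2 : ℂ)‖ * p a + ‖2 * Complex.I‖ * p b + ‖1 + Complex.I‖ * p w := by
        rw [hdecomp, ← map_smul_eq_mul, ← map_smul_eq_mul, ← map_smul_eq_mul]
        exact (map_sub_le_add p _ _).trans (add_le_add_left (map_add_le_add p _ _) _)
    _ ≤ 2 * M + 2 * M + 2 * M := by
        have := apply_nonneg p w
        gcongr <;> simp
    _ = 6 * M := by ring

end SubsetSums

section UniformConvergence

open MeasureTheory

variable {α ι R : Type*} {l : Filter ι} {u v : ι → α → R} {f g : α → R} {K L : ℝ}

theorem eventually_forall_norm_le_add_one_of_tendstoUniformly [SeminormedAddCommGroup R]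
    (hu : TendstoUniformly u f l) (hf : ∀ s, ‖f s‖ ≤ K) : ∀ᶠ i in l, ∀ s, ‖u i s‖ ≤ K + 1 := by
  filter_upwards [Metric.tendstoUniformly_iff.1 hu 1 one_pos] with i hi s
  have hdist := hi s
  rw [dist_eq_norm] at hdist
  linarith [norm_le_norm_add_norm_sub (f s) (u i s), hf s]

theorem tendstoUniformly_mul_of_forall_norm_le [NormedRing R] [ProperSpace R]
    (hu : TendstoUniformly u f l) (hv : TendstoUniformly v g l) (hf : ∀ s, ‖f s‖ ≤ K)
    (hg : ∀ s, ‖g s‖ ≤ L) : TendstoUniformly (fun i => u i * v i) (f * g) l := by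
  have hcpt := (isCompact_closedBall (0 : R) (K + 1)).prod (isCompact_closedBall (0 : R) (L + 1))
  refine UniformContinuousOn.comp_tendstoUniformly_eventually (F := fun i s => (u i s, v i s))
    (f := fun s => (f s, g s)) ?_ (fun s => ?_)
    (hcpt.uniformContinuousOn_of_continuous continuous_mul.continuousOn)
    fun w hw => tendsto_diag.eventually (hu.prodMk hv w hw)
  · filter_upwards [eventually_forall_norm_le_add_one_of_tendstoUniformly hu hf,
      eventually_forall_norm_le_add_one_of_tendstoUniformly hv hg] with i hui hvi s
    simpa using ⟨hui s, hvi s⟩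
  · simpa using ⟨(hf s).trans (by simp), (hg s).trans (by simp)⟩

theorem exists_simpleFunc_forall_dist_le {S E : Type*} [MeasurableSpace S] [PseudoMetricSpace E]
    [MeasurableSpace E] [OpensMeasurableSpace E] [Nonempty E] {h : S → E} (hh : Measurable h)
    (hb : TotallyBounded (Set.range h)) {ε : ℝ} (hε : 0 < ε) :
    ∃ g : SimpleFunc S E, ∀ s, dist (h s) (g s) ≤ ε := by
  obtain ⟨t, htf, ht⟩ := Metric.totallyBounded_iff.1 hb ε hε
  obtain ⟨e, he⟩ := Set.countable_iff_exists_subset_range.1 htf.countable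
  choose! k hk using fun y (hy : y ∈ t) => Set.mem_range.1 (he hy)
  refine ⟨(SimpleFunc.nearestPt e (htf.toFinset.sup k)).comp h hh, fun s => ?_⟩
  obtain ⟨y, hyt, hy⟩ := Set.mem_iUnion₂.1 (ht ⟨s, rfl⟩)
  have hnearest := SimpleFunc.edist_nearestPt_le e (h s)
    (Finset.le_sup (f := k) (htf.mem_toFinset.2 hyt))
  rw [hk y hyt, edist_dist, edist_dist, ENNReal.ofReal_le_ofReal_iff dist_nonneg, dist_comm,
    dist_comm y] at hnearest
  exact hnearest.trans (Metric.mem_ball.1 hy).le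

theorem exists_simpleFunc_tendstoUniformly {S E : Type*} [MeasurableSpace S] [PseudoMetricSpace E]
    [MeasurableSpace E] [OpensMeasurableSpace E] [Nonempty E] {h : S → E} (hh : Measurable h)
    (hb : TotallyBounded (Set.range h)) :
    ∃ g : ℕ → SimpleFunc S E, TendstoUniformly (fun n s => g n s) h atTop := by
  choose g hg using fun n : ℕ =>
    exists_simpleFunc_forall_dist_le hh hb (Nat.one_div_pos_of_nat (α := ℝ) (n := n))
  refine ⟨g, Metric.tendstoUniformly_iff.2 fun ε hε => ?_⟩
  filter_upwards [tendsto_one_div_add_atTop_nhds_zero_nat.eventually (gt_mem_nhds hε)] with n hn s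
  exact (hg n s).trans_lt hn

end UniformConvergence

namespace OperatorSpectralMeasure

open MeasureTheory

variable {F : Type*} [AddCommGroup F] [Module ℂ F] [TopologicalSpace F]
  [IsTopologicalAddGroup F] [ContinuousSMul ℂ F] [PolynormableSpace ℂ F] [T2Space F]
  {S : Type*} [MeasurableSpace S] (m : OperatorSpectralMeasure S F)

theorem toFun_empty : m.toFun ∅ = 0 := by
  ext x
  refine eq_of_forall_dual fun y => ?_
  have h := m.hasSum_iUnion (fun _ => ∅) (fun _ => .empty) (fun _ _ _ => by simp) x y
  simpa using (summable_const_iff _).1 h.summable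

open Classical in
/-- The scalar measure `A ↦ y (m A x)` of a spectral measure, extended by `0` to non-measurable
sets. -/
noncomputable def toComplexMeasure (x : F) (y : F →L[ℂ] ℂ) : ComplexMeasure S where
  measureOf' A := if MeasurableSet A then y (m.toFun A x) else 0
  empty' := by simp [toFun_empty]
  not_measurable' A hA := by simp [hA]
  m_iUnion' A hA hd := by
    simpa [hA, MeasurableSet.iUnion hA] using m.hasSum_iUnion A hA hd x y

theorem toComplexMeasure_apply (x : F) (y : F →L[ℂ] ℂ) {A : Set S} (hA : MeasurableSet A) :
    m.toComplexMeasure x y A = y (m.toFun A x) := if_pos hA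

theorem toFun_biUnion_finset {ι : Type*} {t : Finset ι} {A : ι → Set S}
    (hA : ∀ i ∈ t, MeasurableSet (A i)) (hd : (t : Set ι).PairwiseDisjoint A) :
    m.toFun (⋃ i ∈ t, A i) = ∑ i ∈ t, m.toFun (A i) := by
  ext x
  refine eq_of_forall_dual fun y => ?_
  rw [← toComplexMeasure_apply m x y (t.measurableSet_biUnion hA),
    VectorMeasure.of_biUnion_finset hd hA, sum_apply, map_sum]
  exact Finset.sum_congr rfl fun i hi => toComplexMeasure_apply m x y (hA i hi)

theorem toFun_union {A B : Set S} (hA : MeasurableSet A) (hB : MeasurableSet B)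
    (h : Disjoint A B) : m.toFun (A ∪ B) = m.toFun A + m.toFun B := by
  ext x
  refine eq_of_forall_dual fun y => ?_
  simpa [toComplexMeasure_apply, hA, hB, hA.union hB] using
    (m.toComplexMeasure x y).of_union h hA hB

theorem toFun_compl {A : Set S} (hA : MeasurableSet A) : m.toFun Aᶜ = 1 - m.toFun A := by
  rw [eq_sub_iff_add_eq', ← m.toFun_union hA hA.compl disjoint_compl_right, Set.union_compl_self,
    m.univ_eq_one]

theorem toFun_mul_of_disjoint {A B : Set S} (hA : MeasurableSet A) (hB : MeasurableSet B)
    (h : Disjoint A B) : m.toFun A * m.toFun B = 0 := by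
  rw [← m.inter_eq_mul A B hA hB, h.inter_eq, toFun_empty]

theorem simpleIntegral_map {β : Type*} (g : SimpleFunc S β) (φ : β → ℂ) :
    m.simpleIntegral (g.map φ) = ∑ b ∈ g.range, φ b • m.toFun (g ⁻¹' {b}) := by
  classical
  rw [simpleIntegral, SimpleFunc.range_map,
    ← Finset.sum_fiberwise_of_maps_to (s := g.range) (t := g.range.image φ) (g := φ)
      fun b hb => Finset.mem_image_of_mem φ hb]
  refine Finset.sum_congr rfl fun c _ => ?_
  rw [SimpleFunc.map_preimage_singleton, ← Finset.set_biUnion_preimage_singleton,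
    toFun_biUnion_finset _ (fun b _ => g.measurableSet_preimage _)
      (Set.pairwiseDisjoint_fiber g _), Finset.smul_sum]
  exact Finset.sum_congr rfl fun b hb => by rw [(Finset.mem_filter.1 hb).2]

theorem simpleIntegral_add (g h : SimpleFunc S ℂ) :
    m.simpleIntegral (g + h) = m.simpleIntegral g + m.simpleIntegral h := by
  change m.simpleIntegral ((g.pair h).map fun b => b.1 + b.2) =
    m.simpleIntegral ((g.pair h).map Prod.fst) + m.simpleIntegral ((g.pair h).map Prod.snd)
  simp only [simpleIntegral_map, ← Finset.sum_add_distrib, add_smul]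

theorem simpleIntegral_smul (c : ℂ) (g : SimpleFunc S ℂ) :
    m.simpleIntegral (c • g) = c • m.simpleIntegral g := by
  change m.simpleIntegral (g.map fun b => c • b) = _
  rw [simpleIntegral_map, simpleIntegral, Finset.smul_sum]
  simp only [smul_smul, smul_eq_mul]

theorem simpleIntegral_mul (g h : SimpleFunc S ℂ) :
    m.simpleIntegral (g * h) = m.simpleIntegral g * m.simpleIntegral h := by
  change m.simpleIntegral ((g.pair h).map fun b => b.1 * b.2) =
    m.simpleIntegral ((g.pair h).map Prod.fst) * m.simpleIntegral ((g.pair h).map Prod.snd)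
  simp only [simpleIntegral_map, Finset.sum_mul_sum]
  have hmeas := (g.pair h).measurableSet_preimage
  refine Finset.sum_congr rfl fun b hb => ?_
  rw [Finset.sum_eq_single_of_mem b hb]
  · rw [smul_mul_smul_comm, ← m.inter_eq_mul _ _ (hmeas _) (hmeas _), Set.inter_self]
  · intro b' _ hne
    rw [smul_mul_smul_comm, m.toFun_mul_of_disjoint (hmeas _) (hmeas _)
      (Disjoint.preimage _ (by simpa using hne.symm)), smul_zero]

theorem simpleIntegral_restrict_one {A : Set S} (hA : MeasurableSet A) :
    m.simpleIntegral ((SimpleFunc.const S 1).restrict A) = m.toFun A := by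
  have hpre : ((SimpleFunc.const S (1 : ℂ)).restrict A) ⁻¹' {1} = A := by
    rw [SimpleFunc.restrict_preimage_singleton _ hA one_ne_zero]
    exact Set.inter_eq_left.2 fun _ _ => rfl
  rw [simpleIntegral, Finset.sum_eq_single 1, hpre, one_smul]
  · intro c hc hc1
    obtain ⟨rfl, -⟩ | ⟨s, -, rfl⟩ := (SimpleFunc.mem_restrict_range hA).1 hc
    · rw [zero_smul]
    · exact absurd rfl hc1
  · intro h
    rw [(SimpleFunc.preimage_eq_empty_iff _ _).2 h, toFun_empty, smul_zero]

theorem seminorm_simpleIntegral_le {p q : Seminorm ℂ F}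
    (hpq : ∀ A : Set S, MeasurableSet A → ∀ x : F, p (m.toFun A x) ≤ q x)
    (g : SimpleFunc S ℂ) {K : ℝ} (hK : 0 ≤ K) (hg : ∀ s, ‖g s‖ ≤ K) (x : F) :
    p (m.simpleIntegral g x) ≤ K * (6 * q x) := by
  have hgK : ∀ c ∈ g.range, ‖c‖ ≤ K := fun c hc => by
    obtain ⟨s, rfl⟩ := SimpleFunc.mem_range.1 hc
    exact hg s
  have hscale : m.simpleIntegral g x =
      (K : ℂ) • ∑ c ∈ g.range, (c / K) • m.toFun (g ⁻¹' {c}) x := by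
    rw [simpleIntegral, sum_apply, Finset.smul_sum]
    refine Finset.sum_congr rfl fun c hc => ?_
    rw [smul_apply, smul_smul, mul_div_cancel_of_imp']
    intro hK0
    have := hgK c hc
    rwa [Complex.ofReal_eq_zero.1 hK0, norm_le_zero_iff] at this
  rw [hscale, map_smul_eq_mul, Complex.norm_real, Real.norm_of_nonneg hK]
  refine mul_le_mul_of_nonneg_left (seminorm_sum_smul_le p (fun t _ => ?_) fun c hc => ?_) hK
  · rw [← sum_apply, ← m.toFun_biUnion_finset (fun c _ => g.measurableSet_preimage _)
      (Set.pairwiseDisjoint_fiber g _)]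
    exact hpq _ (t.measurableSet_biUnion fun c _ => g.measurableSet_preimage _) x
  · rw [norm_div, Complex.norm_real, Real.norm_of_nonneg hK]
    exact div_le_one_of_le₀ (hgK c hc) hK

end OperatorSpectralMeasure

namespace OperatorSpectralMeasure

open MeasureTheory

variable {F : Type*} [AddCommGroup F] [Module ℂ F] [TopologicalSpace F]
  [IsTopologicalAddGroup F] [ContinuousSMul ℂ F] {S : Type*} [MeasurableSpace S]
  {m : OperatorSpectralMeasure S F} {f g : S → ℂ} {U V : F →L[ℂ] F}

theorem HasIntegral.congr (hf : m.HasIntegral f U) (h : ∀ s, g s = f s) : m.HasIntegral g U :=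
  (funext h : g = f) ▸ hf

theorem HasIntegral.measurable (hf : m.HasIntegral f U) : Measurable f := by
  obtain ⟨u, hu, -⟩ := hf
  exact measurable_of_tendsto_metrizable (fun n => (u n).measurable)
    (tendsto_pi_nhds.2 hu.tendsto_at)

theorem HasIntegral.exists_forall_norm_le (hf : m.HasIntegral f U) :
    ∃ K : ℝ, 0 ≤ K ∧ ∀ s, ‖f s‖ ≤ K := by
  obtain ⟨u, hu, -⟩ := hf
  obtain ⟨n, hn⟩ := (Metric.tendstoUniformly_iff.1 hu 1 one_pos).exists
  obtain ⟨C, hC⟩ := (u n).exists_forall_norm_le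
  refine ⟨|C| + 1, by positivity, fun s => ?_⟩
  have hdist := hn s
  rw [dist_eq_norm] at hdist
  linarith [norm_le_norm_add_norm_sub' (f s) (u n s), hC s, le_abs_self C]

theorem hasIntegral_simpleFunc (m : OperatorSpectralMeasure S F) (g : SimpleFunc S ℂ) :
    m.HasIntegral g (m.simpleIntegral g) :=
  ⟨fun _ => g, fun _ hu => .of_forall fun _ _ => refl_mem_uniformity hu,
    fun _ => tendsto_const_nhds⟩

variable [PolynormableSpace ℂ F] [T2Space F]

theorem hasIntegral_indicator (m : OperatorSpectralMeasure S F) {A : Set S}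
    (hA : MeasurableSet A) : m.HasIntegral (A.indicator 1) (m.toFun A) := by
  have := m.hasIntegral_simpleFunc ((SimpleFunc.const S 1).restrict A)
  rwa [m.simpleIntegral_restrict_one hA, SimpleFunc.coe_restrict _ hA] at this

theorem HasIntegral.add (hf : m.HasIntegral f U) (hg : m.HasIntegral g V) :
    m.HasIntegral (f + g) (U + V) := by
  obtain ⟨u, hu, huU⟩ := hf
  obtain ⟨v, hv, hvV⟩ := hg
  refine ⟨fun n => u n + v n, hu.add hv, fun x => ?_⟩
  simpa [simpleIntegral_add] using (huU x).add (hvV x)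

theorem HasIntegral.smul (c : ℂ) (hf : m.HasIntegral f U) : m.HasIntegral (c • f) (c • U) := by
  obtain ⟨u, hu, huU⟩ := hf
  refine ⟨fun n => c • u n, (uniformContinuous_const_smul c).comp_tendstoUniformly hu, fun x => ?_⟩
  simpa [simpleIntegral_smul] using (huU x).const_smul c

theorem HasIntegral.sub (hf : m.HasIntegral f U) (hg : m.HasIntegral g V) :
    m.HasIntegral (f - g) (U - V) := by
  simpa [sub_eq_add_neg] using hf.add (hg.smul (-1))

theorem hasIntegral_const (m : OperatorSpectralMeasure S F) (c : ℂ) :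
    m.HasIntegral (fun _ => c) (c • 1) := by
  rw [← m.univ_eq_one]
  exact ((m.hasIntegral_indicator .univ).smul c).congr fun s => by simp

theorem IsEquicontinuous.exists_seminorm_integral_le (hm : m.IsEquicontinuous)
    {p : Seminorm ℂ F} (hp : Continuous p) :
    ∃ q : Seminorm ℂ F, Continuous q ∧ ∀ {g : S → ℂ} {V : F →L[ℂ] F} {K : ℝ},
      m.HasIntegral g V → 0 ≤ K → (∀ s, ‖g s‖ ≤ K) → ∀ x, p (V x) ≤ K * q x := by
  obtain ⟨q, hq, hpq⟩ := hm p hp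
  have hsix : ∀ x, ((6 : NNReal) • q) x = 6 * q x := fun x => rfl
  refine ⟨(6 : NNReal) • q, hq.const_smul (6 : NNReal), ?_⟩
  rintro g V K ⟨u, hu, huV⟩ hK hgK x
  refine le_of_forall_pos_le_add fun ε hε => ?_
  set η := ε / (6 * q x + 1) with hη
  have := apply_nonneg q x
  have hη0 : 0 < η := by positivity
  refine le_of_tendsto ((hp.tendsto _).comp (huV x)) ?_
  filter_upwards [Metric.tendstoUniformly_iff.1 hu η hη0] with n hn
  have hun : ∀ s, ‖u n s‖ ≤ K + η := fun s => by
    have hdist := hn s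
    rw [dist_eq_norm] at hdist
    linarith [norm_le_norm_add_norm_sub (g s) (u n s), hgK s]
  calc p (m.simpleIntegral (u n) x)
      ≤ (K + η) * (6 * q x) := m.seminorm_simpleIntegral_le hpq _ (by positivity) hun x
    _ ≤ K * (6 * q x) + η * (6 * q x + 1) := by linarith
    _ = K * ((6 : NNReal) • q) x + ε := by rw [hsix, hη, div_mul_cancel₀ _ (by positivity)]

theorem HasIntegral.tendsto_of_tendstoUniformly (hm : m.IsEquicontinuous) {ι : Type*}
    {l : Filter ι} {u : ι → S → ℂ} {V : ι → F →L[ℂ] F} (hu : ∀ i, m.HasIntegral (u i) (V i))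
    (hf : m.HasIntegral f U) (huf : TendstoUniformly u f l) (x : F) :
    Tendsto (fun i => V i x) l (𝓝 (U x)) := by
  refine tendsto_nhds_iff_forall_seminorm.2 fun p hp => Metric.tendsto_nhds.2 fun ε hε => ?_
  obtain ⟨q, -, hpq⟩ := hm.exists_seminorm_integral_le hp
  have := apply_nonneg q x
  have hη : 0 < ε / (q x + 1) := by positivity
  filter_upwards [Metric.tendstoUniformly_iff.1 huf _ hη] with i hi
  have hle := hpq ((hu i).sub hf) hη.le
    (fun s => by simpa [dist_eq_norm, norm_sub_rev] using (hi s).le) x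
  rw [Real.dist_eq, sub_zero, abs_of_nonneg (apply_nonneg _ _)]
  calc p (V i x - U x) ≤ ε / (q x + 1) * q x := hle
    _ < ε / (q x + 1) * (q x + 1) := by gcongr; exact lt_add_one _
    _ = ε := div_mul_cancel₀ _ (by positivity)

theorem HasIntegral.unique (hm : m.IsEquicontinuous) (hU : m.HasIntegral f U)
    (hV : m.HasIntegral f V) : U = V := by
  ext x
  have hconst : TendstoUniformly (fun _ : ℕ => f) f atTop :=
    fun _ hu => .of_forall fun _ _ => refl_mem_uniformity hu
  exact tendsto_nhds_unique tendsto_const_nhds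
    (HasIntegral.tendsto_of_tendstoUniformly hm (fun _ => hU) hV hconst x)

theorem HasIntegral.mul (hm : m.IsEquicontinuous) (hf : m.HasIntegral f U)
    (hg : m.HasIntegral g V) : m.HasIntegral (f * g) (U * V) := by
  obtain ⟨K, hK, hfK⟩ := hf.exists_forall_norm_le
  obtain ⟨L, -, hgL⟩ := hg.exists_forall_norm_le
  obtain ⟨u, hu, huU⟩ := hf
  obtain ⟨v, hv, hvV⟩ := hg
  refine ⟨fun n => u n * v n, tendstoUniformly_mul_of_forall_norm_le hu hv hfK hgL, fun x => ?_⟩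
  have hdiff : Tendsto (fun n => m.simpleIntegral (u n) (m.simpleIntegral (v n) x - V x)) atTop
      (𝓝 0) := by
    refine tendsto_nhds_iff_forall_seminorm.2 fun p hp => ?_
    obtain ⟨q, hq, hpq⟩ := hm.exists_seminorm_integral_le hp
    have hlim := (tendsto_nhds_iff_forall_seminorm.1 (hvV x) q hq).const_mul (K + 1)
    rw [mul_zero] at hlim
    refine squeeze_zero' (.of_forall fun _ => apply_nonneg _ _) ?_ hlim
    filter_upwards [eventually_forall_norm_le_add_one_of_tendstoUniformly hu hfK] with n hn
    rw [sub_zero]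
    exact hpq (m.hasIntegral_simpleFunc (u n)) (by positivity) hn _
  simpa [simpleIntegral_mul] using hdiff.add (huU (V x))

theorem HasIntegral.commute (hm : m.IsEquicontinuous) (hf : m.HasIntegral f U)
    (hg : m.HasIntegral g V) : Commute U V :=
  (hf.mul hm hg).unique hm (mul_comm f g ▸ hg.mul hm hf)

theorem HasIntegral.pow (hm : m.IsEquicontinuous) (hf : m.HasIntegral f U) (n : ℕ) :
    m.HasIntegral (f ^ n) (U ^ n) := by
  induction n with
  | zero =>
    rw [pow_zero, pow_zero]
    exact one_smul ℂ (1 : F →L[ℂ] F) ▸ m.hasIntegral_const 1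
  | succ n ih => simpa only [pow_succ] using ih.mul hm hf

end OperatorSpectralMeasure

theorem compl_preimage_singleton_eq_iUnion {S E : Type*} [NormedAddCommGroup E] (f : S → E)
    (ξ : E) : (f ⁻¹' {ξ})ᶜ = ⋃ k : ℕ, {s | 1 / ((k : ℝ) + 1) ≤ ‖ξ - f s‖} := by
  ext s
  simp only [Set.mem_compl_iff, Set.mem_preimage, Set.mem_singleton_iff, Set.mem_iUnion,
    Set.mem_ofPred_eq]
  refine ⟨fun hs => ?_, fun ⟨k, hk⟩ hs => ?_⟩
  · obtain ⟨k, hk⟩ := exists_nat_one_div_lt (norm_pos_iff.2 (sub_ne_zero.2 (Ne.symm hs)))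
    exact ⟨k, hk.le⟩
  · rw [hs, sub_self, norm_zero] at hk
    exact hk.not_gt Nat.one_div_pos_of_nat

namespace OperatorSpectralMeasure

open MeasureTheory

variable {F : Type*} [AddCommGroup F] [Module ℂ F] [TopologicalSpace F]
  [IsTopologicalAddGroup F] [ContinuousSMul ℂ F] {S : Type*} [MeasurableSpace S]
  {m : OperatorSpectralMeasure S F} {f : S → ℂ} {U : F →L[ℂ] F} {D : Set S} {ξ : ℂ} {δ : ℝ}

theorem toFun_toFun_apply (m : OperatorSpectralMeasure S F) {A B : Set S} (hA : MeasurableSet A)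
    (hB : MeasurableSet B) (x : F) : m.toFun A (m.toFun B x) = m.toFun (A ∩ B) x := by
  rw [m.inter_eq_mul A B hA hB, mul_apply_eq_comp]

variable [PolynormableSpace ℂ F] [T2Space F]

theorem tendsto_dual_toFun_iUnion (m : OperatorSpectralMeasure S F) {A : ℕ → Set S}
    (hA : ∀ k, MeasurableSet (A k)) (hmono : Monotone A) (x : F) (y : F →L[ℂ] ℂ) :
    Tendsto (fun k => y (m.toFun (A k) x)) atTop (𝓝 (y (m.toFun (⋃ k, A k) x))) := by
  simpa only [toComplexMeasure_apply, hA, MeasurableSet.iUnion hA] using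
    (m.toComplexMeasure x y).tendsto_vectorMeasure_iUnion_atTop_nat hmono hA

theorem HasIntegral.tendsto_dual_toFun_compl_preimage_singleton (hU : m.HasIntegral f U) (ξ : ℂ)
    (x : F) (y : F →L[ℂ] ℂ) :
    Tendsto (fun k : ℕ => y (m.toFun {s | 1 / ((k : ℝ) + 1) ≤ ‖ξ - f s‖} x)) atTop
      (𝓝 (y (m.toFun (f ⁻¹' {ξ})ᶜ x))) := by
  rw [compl_preimage_singleton_eq_iUnion]
  exact m.tendsto_dual_toFun_iUnion
    (fun k => measurableSet_le measurable_const (measurable_const.sub hU.measurable).norm)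
    (fun i j hij s (hs : 1 / ((i : ℝ) + 1) ≤ ‖ξ - f s‖) =>
      (Nat.one_div_le_one_div hij).trans hs) x y

/-- The integrals of simple functions approximating `(ξ - f)⁻¹` on `D` are approximate inverses of
`ξ - U` there. -/
theorem HasIntegral.exists_commute_tendsto_toFun (hm : m.IsEquicontinuous)
    (hU : m.HasIntegral f U) (hD : MeasurableSet D) (hδ : 0 < δ)
    (hfD : ∀ s ∈ D, δ ≤ ‖ξ - f s‖) :
    ∃ V : ℕ → F →L[ℂ] F, (∀ n, Commute (V n) (ξ • 1 - U)) ∧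
      ∀ x, Tendsto (fun n => V n ((ξ • (1 : F →L[ℂ] F) - U) x)) atTop (𝓝 (m.toFun D x)) := by
  have hξU := (m.hasIntegral_const ξ).sub hU
  obtain ⟨K, -, hK⟩ := hξU.exists_forall_norm_le
  set h : S → ℂ := D.indicator fun s => (ξ - f s)⁻¹
  have hbound : ∀ s, ‖h s‖ ≤ δ⁻¹ := fun s => by
    rw [norm_indicator_eq_indicator_norm]
    refine Set.indicator_apply_le' (fun hs => ?_) fun _ => by positivity
    rw [norm_inv]
    exact inv_anti₀ hδ (hfD s hs)
  have hmul : h * ((fun _ => ξ) - f) = D.indicator 1 := by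
    ext s
    rw [Pi.mul_apply, ← Set.indicator_mul_left]
    refine congrFun (Set.indicator_congr fun s hs => inv_mul_cancel₀ ?_) s
    exact norm_pos_iff.1 (hδ.trans_le (hfD s hs))
  obtain ⟨g, hg⟩ := exists_simpleFunc_tendstoUniformly
    ((measurable_const.sub hU.measurable).inv.indicator hD : Measurable h)
    ((isCompact_closedBall (0 : ℂ) δ⁻¹).totallyBounded.subset
      (Set.range_subset_iff.2 fun s => mem_closedBall_zero_iff.2 (hbound s)))
  have hgI := fun n => m.hasIntegral_simpleFunc (g n)
  have hconst : TendstoUniformly (fun _ : ℕ => (fun _ => ξ) - f) ((fun _ => ξ) - f) atTop :=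
    fun _ hu => .of_forall fun _ _ => refl_mem_uniformity hu
  refine ⟨fun n => m.simpleIntegral (g n), fun n => (hgI n).commute hm hξU, fun x => ?_⟩
  exact HasIntegral.tendsto_of_tendstoUniformly hm (fun n => (hgI n).mul hm hξU)
    (m.hasIntegral_indicator hD)
    (hmul ▸ tendstoUniformly_mul_of_forall_norm_le hg hconst hbound hK) x

theorem HasIntegral.toFun_apply_mem_closure_range (hm : m.IsEquicontinuous)
    (hU : m.HasIntegral f U) (hD : MeasurableSet D) (hδ : 0 < δ)
    (hfD : ∀ s ∈ D, δ ≤ ‖ξ - f s‖) (x : F) :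
    m.toFun D x ∈ closure (Set.range (ξ • (1 : F →L[ℂ] F) - U)) := by
  obtain ⟨V, hVU, hV⟩ := hU.exists_commute_tendsto_toFun hm hD hδ hfD
  exact mem_closure_of_tendsto (hV x)
    (.of_forall fun n => ⟨V n x, (DFunLike.congr_fun (hVU n).eq x).symm⟩)

theorem HasIntegral.toFun_apply_eq_zero (hm : m.IsEquicontinuous)
    (hU : m.HasIntegral f U) (hD : MeasurableSet D) (hδ : 0 < δ)
    (hfD : ∀ s ∈ D, δ ≤ ‖ξ - f s‖) {x : F} (hx : U x = ξ • x) : m.toFun D x = 0 := by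
  obtain ⟨V, -, hV⟩ := hU.exists_commute_tendsto_toFun hm hD hδ hfD
  exact tendsto_nhds_unique (hV x) (by simp [hx])

theorem HasIntegral.toFun_compl_preimage_singleton_mem_closure_range (hm : m.IsEquicontinuous)
    (hU : m.HasIntegral f U) (ξ : ℂ) (x : F) :
    m.toFun (f ⁻¹' {ξ})ᶜ x ∈ closure (Set.range (ξ • (1 : F →L[ℂ] F) - U)) := by
  rw [← closure_closure]
  exact mem_closure_of_tendsto_dual (N := (ξ • (1 : F →L[ℂ] F) - U).range.topologicalClosure)
    (fun k => hU.toFun_apply_mem_closure_range hm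
      (measurableSet_le measurable_const (measurable_const.sub hU.measurable).norm)
      Nat.one_div_pos_of_nat (fun _ hs => hs) x)
    (hU.tendsto_dual_toFun_compl_preimage_singleton ξ x)

theorem HasIntegral.toFun_compl_preimage_singleton_eq_zero (hm : m.IsEquicontinuous)
    (hU : m.HasIntegral f U) {x : F} (hx : U x = ξ • x) : m.toFun (f ⁻¹' {ξ})ᶜ x = 0 := by
  refine eq_zero_of_forall_dual fun y =>
    tendsto_nhds_unique (hU.tendsto_dual_toFun_compl_preimage_singleton ξ x y) ?_
  have h0 (k : ℕ) : m.toFun {s | 1 / ((k : ℝ) + 1) ≤ ‖ξ - f s‖} x = 0 :=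
    hU.toFun_apply_eq_zero hm
      (measurableSet_le measurable_const (measurable_const.sub hU.measurable).norm)
      Nat.one_div_pos_of_nat (fun _ hs => hs) hx
  simp only [h0, map_zero, tendsto_const_nhds]

theorem HasIntegral.toFun_mul_eq_smul (hm : m.IsEquicontinuous) (hU : m.HasIntegral f U)
    (hD : MeasurableSet D) (h : ∀ s ∈ D, f s = ξ) : m.toFun D * U = ξ • m.toFun D := by
  have hI := m.hasIntegral_indicator hD
  refine (hI.mul hm hU).unique hm ((hI.smul ξ).congr fun s => ?_)
  by_cases hs : s ∈ D <;> simp [hs, h]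

theorem HasIntegral.apply_toFun_preimage_singleton (hm : m.IsEquicontinuous)
    (hU : m.HasIntegral f U) (ξ : ℂ) (x : F) :
    U (m.toFun (f ⁻¹' {ξ}) x) = ξ • m.toFun (f ⁻¹' {ξ}) x := by
  have hmeas := hU.measurable (measurableSet_singleton ξ)
  have hcomm := (m.hasIntegral_indicator hmeas).commute hm hU
  have h := hcomm.eq.symm.trans (hU.toFun_mul_eq_smul hm hmeas fun _ => id)
  exact DFunLike.congr_fun h x

theorem HasIntegral.toFun_preimage_singleton_apply_eq_self (hm : m.IsEquicontinuous)
    (hU : m.HasIntegral f U) {x : F} (hx : U x = ξ • x) : m.toFun (f ⁻¹' {ξ}) x = x := by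
  have h0 := hU.toFun_compl_preimage_singleton_eq_zero hm hx
  rw [m.toFun_compl (hU.measurable (measurableSet_singleton ξ))] at h0
  exact (sub_eq_zero.1 h0).symm

theorem HasIntegral.range_resolution_singleton (hm : m.IsEquicontinuous)
    (hU : m.HasIntegral f U) (ξ : ℂ) :
    Set.range (m.resolution f {ξ}) = {x : F | U x = ξ • x} := by
  refine Set.Subset.antisymm ?_ fun x hx =>
    ⟨x, hU.toFun_preimage_singleton_apply_eq_self hm hx⟩
  rintro _ ⟨x, rfl⟩
  exact hU.apply_toFun_preimage_singleton hm ξ x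

theorem HasIntegral.resolution_singleton_ne_zero_iff (hm : m.IsEquicontinuous)
    (hU : m.HasIntegral f U) (ξ : ℂ) :
    m.resolution f {ξ} ≠ 0 ↔ ξ ∈ opPointSpectrum U := by
  constructor
  · intro h
    have hinj : ¬ Function.Injective (ξ • (1 : F →L[ℂ] F) - U) := fun hinj => h <| by
      ext x
      refine hinj ?_
      simp [resolution, hU.apply_toFun_preimage_singleton hm ξ x]
    exact ⟨fun hr => hinj hr.2.injective, hinj⟩
  · rintro ⟨-, hinj⟩ h
    refine hinj ((injective_iff_map_eq_zero _).2 fun x hx => ?_)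
    have hUx : U x = ξ • x := (sub_eq_zero.1 (by simpa using hx)).symm
    rw [← hU.toFun_preimage_singleton_apply_eq_self hm hUx]
    exact DFunLike.congr_fun h x

end OperatorSpectralMeasure

section MeanErgodic

variable {F : Type*} [AddCommGroup F] [Module ℂ F] [TopologicalSpace F]
  [IsTopologicalAddGroup F] [ContinuousSMul ℂ F] {T : F →L[ℂ] F} {x : F}

/-- The powers of the operator `T` form an equicontinuous family. -/
def IsPowerEquicontinuous (T : F →L[ℂ] F) : Prop :=
  ∀ p : Seminorm ℂ F, Continuous p → ∃ q : Seminorm ℂ F, Continuous q ∧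
    ∀ (n : ℕ) (x : F), p ((T ^ n) x) ≤ q x

theorem opAverage_apply (n : ℕ) (T : F →L[ℂ] F) (x : F) :
    opAverage n T x = (n : ℂ)⁻¹ • ∑ k ∈ Finset.range n, (T ^ k) x := by
  rw [opAverage, smul_apply, sum_apply]

theorem opAverage_apply_of_apply_eq_self (hx : T x = x) {n : ℕ} (hn : n ≠ 0) :
    opAverage n T x = x := by
  have hpow : ∀ k, (T ^ k) x = x := fun k => by
    induction k with
    | zero => rfl
    | succ k ih => rw [pow_succ, mul_apply_eq_comp, hx, ih]
  rw [opAverage_apply, Finset.sum_congr rfl fun k _ => hpow k, Finset.sum_const,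
    Finset.card_range, ← Nat.cast_smul_eq_nsmul ℂ, inv_smul_smul₀ (Nat.cast_ne_zero.2 hn)]

theorem opAverage_one_sub_apply (n : ℕ) (T : F →L[ℂ] F) (x : F) :
    opAverage n T ((1 - T) x) = (n : ℂ)⁻¹ • (x - (T ^ n) x) := by
  rw [opAverage, smul_apply]
  exact congrArg _ (DFunLike.congr_fun (geom_sum_mul_neg T n) x)

theorem seminorm_opAverage_le {p : Seminorm ℂ F} {c : ℝ} (n : ℕ) (hc : 0 ≤ c)
    (h : ∀ k, p ((T ^ k) x) ≤ c) : p (opAverage n T x) ≤ c := by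
  rw [opAverage_apply, map_smul_eq_mul, norm_inv, Complex.norm_natCast]
  have hsum : p (∑ k ∈ Finset.range n, (T ^ k) x) ≤ n * c :=
    (Finset.le_sum_of_subadditive p (map_zero p).le (map_add_le_add p) _ _).trans <|
      (Finset.sum_le_card_nsmul _ _ _ fun k _ => h k).trans (by simp)
  calc (n : ℝ)⁻¹ * p (∑ k ∈ Finset.range n, (T ^ k) x) ≤ (n : ℝ)⁻¹ * (n * c) := by gcongr
    _ ≤ c := by
      rw [← mul_assoc]
      exact mul_le_of_le_one_left hc inv_mul_le_one

theorem IsPowerEquicontinuous.tendsto_opAverage_of_mem_closure_range [PolynormableSpace ℂ F]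
    (hT : IsPowerEquicontinuous T) (hx : x ∈ closure (Set.range (1 - T : F →L[ℂ] F))) :
    Tendsto (fun n => opAverage n T x) atTop (𝓝 0) := by
  refine tendsto_nhds_iff_forall_seminorm.2 fun p hp => ?_
  obtain ⟨q, hq, hpq⟩ := hT p hp
  refine Metric.tendsto_nhds.2 fun ε hε => ?_
  obtain ⟨_, ⟨w, rfl⟩, hw⟩ := exists_seminorm_sub_lt_of_mem_closure hx hq (half_pos hε)
  have hlim : Tendsto (fun n : ℕ => (n : ℝ)⁻¹ * (p w + q w)) atTop (𝓝 0) := by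
    simpa using (tendsto_inv_atTop_nhds_zero_nat (𝕜 := ℝ)).mul_const (p w + q w)
  filter_upwards [hlim.eventually (gt_mem_nhds (half_pos hε))] with n hn
  have hclose : p (opAverage n T (x - (1 - T) w)) ≤ q (x - (1 - T) w) :=
    seminorm_opAverage_le n (apply_nonneg _ _) fun k => hpq k _
  have hcoboundary : p (opAverage n T ((1 - T) w)) ≤ (n : ℝ)⁻¹ * (p w + q w) := by
    rw [opAverage_one_sub_apply, map_smul_eq_mul, norm_inv, Complex.norm_natCast]
    gcongr
    exact (map_sub_le_add p _ _).trans (by gcongr; exact hpq n w)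
  rw [sub_zero, Real.dist_eq, sub_zero, abs_of_nonneg (apply_nonneg _ _)]
  calc p (opAverage n T x)
      ≤ p (opAverage n T (x - (1 - T) w)) + p (opAverage n T ((1 - T) w)) := by
        simpa only [map_sub, sub_add_cancel] using
          map_add_le_add p (opAverage n T (x - (1 - T) w)) (opAverage n T ((1 - T) w))
    _ < ε := by linarith

end MeanErgodic

namespace OperatorSpectralMeasure

variable {F : Type*} [AddCommGroup F] [Module ℂ F] [TopologicalSpace F]
  [IsTopologicalAddGroup F] [ContinuousSMul ℂ F] [PolynormableSpace ℂ F] [T2Space F]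
  {S : Type*} [MeasurableSpace S] {m : OperatorSpectralMeasure S F} {g : S → ℂ} {T : F →L[ℂ] F}

theorem HasIntegral.isPowerEquicontinuous (hm : m.IsEquicontinuous) (hT : m.HasIntegral g T)
    (hg : ∀ s, ‖g s‖ ≤ 1) : IsPowerEquicontinuous T := by
  intro p hp
  obtain ⟨q, hq, hpq⟩ := hm.exists_seminorm_integral_le hp
  refine ⟨q, hq, fun n x => ?_⟩
  have hgn : ∀ s, ‖(g ^ n) s‖ ≤ 1 := fun s => by
    rw [Pi.pow_apply, norm_pow]
    exact pow_le_one₀ (norm_nonneg _) (hg s)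
  simpa using hpq (hT.pow hm n) zero_le_one hgn x

theorem HasIntegral.tendsto_opAverage (hm : m.IsEquicontinuous) (hT : m.HasIntegral g T)
    (hg : ∀ s, ‖g s‖ ≤ 1) (x : F) :
    Tendsto (fun n => opAverage n T x) atTop (𝓝 (m.toFun (g ⁻¹' {1}) x)) := by
  have hfix : T (m.toFun (g ⁻¹' {1}) x) = m.toFun (g ⁻¹' {1}) x := by
    simpa using hT.apply_toFun_preimage_singleton hm 1 x
  have hlim_fix : Tendsto (fun n => opAverage n T (m.toFun (g ⁻¹' {1}) x)) atTop
      (𝓝 (m.toFun (g ⁻¹' {1}) x)) :=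
    tendsto_const_nhds.congr' <| (eventually_ne_atTop 0).mono fun n hn =>
      (opAverage_apply_of_apply_eq_self hfix hn).symm
  have hlim_compl : Tendsto (fun n => opAverage n T (m.toFun (g ⁻¹' {1})ᶜ x)) atTop (𝓝 0) := by
    refine (hT.isPowerEquicontinuous hm hg).tendsto_opAverage_of_mem_closure_range ?_
    simpa using hT.toFun_compl_preimage_singleton_mem_closure_range hm 1 x
  simpa [← map_add, m.toFun_compl (hT.measurable (measurableSet_singleton 1))] using
    hlim_fix.add hlim_compl

end OperatorSpectralMeasure

section Divergence

open MeasureTheory ProbabilityTheory FourierTransform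

theorem ae_not_exists_tendsto_of_tendsto_integral_mul {X : Type*} [MeasurableSpace X]
    {ν : Measure X} [IsFiniteMeasure ν] {u : ℕ → X → ℂ} (hu : ∀ n, Measurable (u n))
    (hu1 : ∀ n x, ‖u n x‖ = 1)
    (h0 : ∀ h : X → ℂ, Measurable h → Tendsto (fun n => ∫ x, u n x * h x ∂ν) atTop (𝓝 0)) :
    ∀ᵐ x ∂ν, ¬ ∃ c, Tendsto (fun n => u n x) atTop (𝓝 c) := by
  set A := {x | ∃ c, Tendsto (fun n => u n x) atTop (𝓝 c)}
  have hA : MeasurableSet A := measurableSet_exists_tendsto hu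
  choose! s hs using fun x (hx : x ∈ A) => hx
  have hmeas : Measurable (A.indicator s) := by
    refine measurable_of_tendsto_metrizable (fun n => (hu n).indicator hA)
      (tendsto_pi_nhds.2 fun x => ?_)
    by_cases hx : x ∈ A
    · simpa [hx] using hs x hx
    · simp [hx]
  have hconj : Measurable fun x => (starRingEnd ℂ) (A.indicator s x) :=
    Complex.continuous_conj.measurable.comp hmeas
  have hnorm : ∀ x ∈ A, ‖s x‖ = 1 := fun x hx =>
    tendsto_nhds_unique (hs x hx).norm (by simp [hu1])
  have hlim : Tendsto (fun n => ∫ x, u n x * (starRingEnd ℂ) (A.indicator s x) ∂ν) atTop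
      (𝓝 (∫ x, A.indicator 1 x ∂ν)) := by
    refine tendsto_integral_of_dominated_convergence 1
      (fun n => ((hu n).mul hconj).aestronglyMeasurable) (integrable_const 1)
      (fun n => ae_of_all _ fun x => ?_) (ae_of_all _ fun x => ?_)
    · by_cases hx : x ∈ A <;> simp [hx, hu1, hnorm]
    · by_cases hx : x ∈ A
      · simpa [hx, Complex.mul_conj, Complex.normSq_eq_norm_sq, hnorm x hx] using
          (hs x hx).mul_const ((starRingEnd ℂ) (s x))
      · simp [hx]
  have hzero := tendsto_nhds_unique hlim (h0 _ hconj)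
  have hνA : ν A = 0 := by simpa [integral_indicator hA, measureReal_eq_zero_iff] using hzero
  exact measure_eq_zero_iff_ae_notMem.1 hνA

theorem ae_not_exists_tendsto_fourierChar {φ : ℕ → ℕ} (hφ : StrictMono φ) :
    ∀ᵐ t ∂(volume.restrict (Set.Icc (0 : ℝ) 1)),
      ¬ ∃ c : ℂ, Tendsto (fun n => (𝐞 (-(t * φ n)) : ℂ)) atTop (𝓝 c) := by
  refine ae_not_exists_tendsto_of_tendsto_integral_mul (fun n => ?_) (fun n t => Circle.norm_coe _)
    fun h _ => ?_
  · exact (continuous_subtype_val.comp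
      (Real.continuous_fourierChar.comp (by fun_prop))).measurable
  · have hcocompact : Tendsto (fun n => (φ n : ℝ)) atTop (cocompact ℝ) :=
      (tendsto_natCast_atTop_atTop.comp hφ.tendsto_atTop).mono_right atTop_le_cocompact
    refine ((Real.tendsto_integral_exp_smul_cocompact
      ((Set.Icc 0 1).indicator h)).comp hcocompact).congr fun n => ?_
    rw [← integral_indicator measurableSet_Icc]
    refine integral_congr_ae (ae_of_all _ fun t => ?_)
    by_cases ht : t ∈ Set.Icc (0 : ℝ) 1
    · simp only [Set.indicator_of_mem ht]
      rfl
    · simp [Set.indicator_of_notMem ht]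

theorem continuous_cdf (μ : Measure ℝ) [IsProbabilityMeasure μ] [NullSingletonClass μ] :
    Continuous (cdf μ) := by
  refine continuous_iff_continuousAt.2 fun t => ?_
  rw [(monotone_cdf μ).continuousAt_iff_leftLim_eq_rightLim, (cdf μ).rightLim_eq]
  have h := (cdf μ).measure_singleton t
  rw [measure_cdf, measure_singleton] at h
  exact le_antisymm ((monotone_cdf μ).leftLim_le le_rfl)
    (sub_nonpos.1 (ENNReal.ofReal_eq_zero.1 h.symm))

theorem measure_preimage_cdf_Iic (μ : Measure ℝ) [IsProbabilityMeasure μ] [NullSingletonClass μ]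
    {a : ℝ} (ha : a ∈ Set.Ico 0 1) : μ (cdf μ ⁻¹' Set.Iic a) = ENNReal.ofReal a := by
  have hsurj : Set.Ioo 0 1 ⊆ Set.range (cdf μ) := fun b hb =>
    mem_range_of_exists_le_of_exists_ge (continuous_cdf μ)
      (((tendsto_cdf_atBot μ).eventually (gt_mem_nhds hb.1)).exists.imp fun _ h => h.le)
      (((tendsto_cdf_atTop μ).eventually (lt_mem_nhds hb.2)).exists.imp fun _ h => h.le)
  refine le_antisymm ?_ ?_
  · refine ge_of_tendsto ((ENNReal.continuous_ofReal.tendsto a).mono_left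
      (nhdsWithin_le_nhds (s := Set.Ioi a))) ?_
    filter_upwards [Ioo_mem_nhdsGT ha.2] with b hb
    obtain ⟨t, rfl⟩ := hsurj ⟨ha.1.trans_lt hb.1, hb.2⟩
    rw [ofReal_cdf]
    refine measure_mono fun r (hr : cdf μ r ≤ a) => ?_
    exact ((monotone_cdf μ).reflect_lt (hr.trans_lt hb.1)).le
  · obtain rfl | ha0 := ha.1.eq_or_lt
    · simp
    obtain ⟨t, rfl⟩ := hsurj ⟨ha0, ha.2⟩
    rw [ofReal_cdf]
    exact measure_mono fun r hr => monotone_cdf μ hr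

theorem map_cdf (μ : Measure ℝ) [IsProbabilityMeasure μ] [NullSingletonClass μ] :
    μ.map (cdf μ) = volume.restrict (Set.Icc 0 1) := by
  have hcont := continuous_cdf μ
  have := Measure.isProbabilityMeasure_map (μ := μ) hcont.aemeasurable
  refine Measure.ext_of_Iic _ _ fun a => ?_
  have hIcc : Set.Iic a ∩ Set.Icc 0 1 = Set.Icc 0 (min 1 a) := by
    ext t
    simp only [Set.mem_inter_iff, Set.mem_Iic, Set.mem_Icc, le_min_iff]
    tauto
  rw [Measure.map_apply hcont.measurable measurableSet_Iic,
    Measure.restrict_apply measurableSet_Iic, hIcc, Real.volume_Icc, sub_zero]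
  obtain ha | ha := lt_or_ge a 0
  · have hempty : cdf μ ⁻¹' Set.Iic a = ∅ :=
      Set.eq_empty_of_forall_notMem fun t ht => (ht.trans_lt ha).not_ge (cdf_nonneg μ t)
    simp [hempty, ENNReal.ofReal_of_nonpos ha.le]
  obtain ha1 | ha1 := le_or_gt 1 a
  · have huniv : cdf μ ⁻¹' Set.Iic a = Set.univ :=
      Set.eq_univ_of_forall fun t => (cdf_le_one μ t).trans ha1
    simp [huniv, ha1]
  · rw [measure_preimage_cdf_Iic μ ⟨ha, ha1⟩, min_eq_right ha1.le]

theorem exists_measurable_map_eq_volume_restrict_Icc {X : Type*} [MeasurableSpace X]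
    [StandardBorelSpace X] (ν : Measure X) [IsProbabilityMeasure ν] [NullSingletonClass ν] :
    ∃ G : X → ℝ, Measurable G ∧ ν.map G = volume.restrict (Set.Icc 0 1) := by
  have he := measurableEmbedding_embeddingReal X
  set μ := ν.map (embeddingReal X)
  have : IsProbabilityMeasure μ := Measure.isProbabilityMeasure_map he.measurable.aemeasurable
  have : NullSingletonClass μ := ⟨fun t => by
    rw [Measure.map_apply he.measurable (measurableSet_singleton t),
      (Set.subsingleton_singleton.preimage he.injective).measure_zero]⟩
  have hcdf := (continuous_cdf μ).measurable
  exact ⟨cdf μ ∘ embeddingReal X, hcdf.comp he.measurable, by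
    rw [← Measure.map_map hcdf he.measurable, map_cdf]⟩

theorem exists_measurable_ae_not_exists_tendsto_fourierChar {X : Type*} [MeasurableSpace X]
    [StandardBorelSpace X] (ν : Measure X) [IsFiniteMeasure ν] [NullSingletonClass ν] :
    ∃ G : X → ℝ, Measurable G ∧ ∀ φ : ℕ → ℕ, StrictMono φ →
      ∀ᵐ x ∂ν, ¬ ∃ c : ℂ, Tendsto (fun n => (𝐞 (-(G x * φ n)) : ℂ)) atTop (𝓝 c) := by
  obtain rfl | h0 := eq_zero_or_neZero ν
  · exact ⟨0, measurable_zero, fun _ _ => ae_zero.le trivial⟩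
  have : NullSingletonClass ((ν Set.univ)⁻¹ • ν) := ⟨fun x => by simp⟩
  obtain ⟨G, hG, hmap⟩ := exists_measurable_map_eq_volume_restrict_Icc ((ν Set.univ)⁻¹ • ν)
  refine ⟨G, hG, fun φ hφ => ?_⟩
  have hac : ν ≪ (ν Set.univ)⁻¹ • ν :=
    Measure.absolutelyContinuous_smul (ENNReal.inv_ne_zero.2 (measure_ne_top _ _))
  have huniform := ae_not_exists_tendsto_fourierChar hφ
  rw [← hmap] at huniform
  exact hac.ae_le (ae_of_ae_map hG.aemeasurable huniform)

end Divergence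

section Differentiation

open MeasureTheory Metric

theorem ae_not_tendsto_measure_closedBall_div_top {β : Type*} [MetricSpace β]
    [MeasurableSpace β] [BorelSpace β] [SecondCountableTopology β] [HasBesicovitchCovering β]
    (ρ ν : Measure β) [IsLocallyFiniteMeasure ρ] [IsLocallyFiniteMeasure ν] :
    ∀ᵐ z ∂ν, ¬ Tendsto (fun r => ρ (closedBall z r) / ν (closedBall z r)) (𝓝[>] 0) (𝓝 ⊤) := by
  filter_upwards [Besicovitch.ae_tendsto_rnDeriv ρ ν, Measure.rnDeriv_lt_top ρ ν]
    with z hz hlt htop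
  exact hlt.ne (tendsto_nhds_unique hz htop)

theorem tendsto_volume_closedBall_div_top {ν : Measure ℂ} [IsFiniteMeasure ν] {ξ : ℂ} {C : ℝ}
    (h : ∀ r > 0, ν.real (closedBall ξ r) ≤ C * r ^ 3) :
    Tendsto (fun r => volume (closedBall ξ r) / ν (closedBall ξ r)) (𝓝[>] 0) (𝓝 ⊤) := by
  have hC : 0 ≤ C := by simpa using measureReal_nonneg.trans (h 1 one_pos)
  have hlim : Tendsto (fun r : ℝ => ENNReal.ofReal (Real.pi / (C + 1) * r⁻¹)) (𝓝[>] 0) (𝓝 ⊤) :=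
    ENNReal.tendsto_ofReal_atTop.comp
      (tendsto_inv_nhdsGT_zero.const_mul_atTop (by positivity))
  refine tendsto_nhds_top_mono hlim ?_
  filter_upwards [self_mem_nhdsWithin] with r (hr : 0 < r)
  have hν : ν (closedBall ξ r) ≤ ENNReal.ofReal ((C + 1) * r ^ 3) := by
    rw [← ofReal_measureReal]
    exact ENNReal.ofReal_le_ofReal ((h r hr).trans (by gcongr; linarith))
  have hvol : volume (closedBall ξ r) = ENNReal.ofReal (r ^ 2 * Real.pi) := by
    rw [Complex.volume_closedBall, ENNReal.ofReal_mul (by positivity), ENNReal.ofReal_pow hr.le,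
      ← NNReal.coe_real_pi, ENNReal.ofReal_coe_nnreal]
  calc ENNReal.ofReal (Real.pi / (C + 1) * r⁻¹)
      = ENNReal.ofReal (r ^ 2 * Real.pi) / ENNReal.ofReal ((C + 1) * r ^ 3) := by
        rw [← ENNReal.ofReal_div_of_pos (by positivity)]
        congr 1
        field_simp
    _ ≤ volume (closedBall ξ r) / ν (closedBall ξ r) := by
        rw [hvol]
        gcongr

end Differentiation

section DominatedMeasures

open MeasureTheory

variable {α : Type*} [MeasurableSpace α]

theorem signedMeasure_eq_zero_of_forall_dominated {κ : SignedMeasure α}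
    (h : ∀ (P : Set α) (ν : Measure α) [IsFiniteMeasure ν], MeasurableSet P →
      (∀ A, MeasurableSet A → ν.real A ≤ |κ (P ∩ A)|) → ν = 0) : κ = 0 := by
  obtain ⟨P, hP, hpos, hneg⟩ := κ.exists_compl_positive_negative
  have hpos0 := h P (κ.toMeasureOfZeroLE P hP hpos) hP fun A hA => by
    rw [κ.toMeasureOfZeroLE_real_apply hpos hP hA]
    exact le_abs_self _
  have hneg0 := h Pᶜ (κ.toMeasureOfLEZero Pᶜ hP.compl hneg) hP.compl fun A hA => by
    rw [κ.toMeasureOfLEZero_real_apply hneg hP.compl hA]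
    exact neg_le_abs _
  ext A hA
  have hκP := κ.toMeasureOfZeroLE_real_apply hpos hP hA
  have hκPc := κ.toMeasureOfLEZero_real_apply hneg hP.compl hA
  rw [hpos0, measureReal_zero_apply] at hκP
  rw [hneg0, measureReal_zero_apply, zero_eq_neg] at hκPc
  have hdisj : Disjoint (P ∩ A) (Pᶜ ∩ A) :=
    disjoint_compl_right.mono Set.inter_subset_left Set.inter_subset_left
  calc κ A = κ (P ∩ A ∪ Pᶜ ∩ A) := by
        rw [← Set.union_inter_distrib_right, Set.union_compl_self, Set.univ_inter]
    _ = 0 := by rw [κ.of_union hdisj (hP.inter hA) (hP.compl.inter hA), ← hκP, hκPc, add_zero]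

theorem complexMeasure_eq_zero_of_forall_dominated {κ : ComplexMeasure α}
    (h : ∀ (P : Set α) (ν : Measure α) [IsFiniteMeasure ν], MeasurableSet P →
      (∀ A, MeasurableSet A → ν.real A ≤ ‖κ (P ∩ A)‖) → ν = 0) : κ = 0 := by
  have hre : ComplexMeasure.re κ = 0 := signedMeasure_eq_zero_of_forall_dominated
    fun P ν _ hP hν => h P ν hP fun A hA => (hν A hA).trans (Complex.abs_re_le_norm _)
  have him : ComplexMeasure.im κ = 0 := signedMeasure_eq_zero_of_forall_dominated
    fun P ν _ hP hν => h P ν hP fun A hA => (hν A hA).trans (Complex.abs_im_le_norm _)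
  ext A _
  exact Complex.ext (DFunLike.congr_fun hre A) (DFunLike.congr_fun him A)

end DominatedMeasures

namespace OperatorSpectralMeasure

open MeasureTheory Metric FourierTransform

variable {F : Type*} [AddCommGroup F] [Module ℂ F] [TopologicalSpace F]
  [IsTopologicalAddGroup F] [ContinuousSMul ℂ F]
  {S : Type*} [MeasurableSpace S] {m : OperatorSpectralMeasure S F} {f : S → ℂ} {U : F →L[ℂ] F}
  {ξ : ℂ} {ν : Measure ℂ} [IsFiniteMeasure ν] {x : F} {y : F →L[ℂ] ℂ}

theorem resolution_resolution (m : OperatorSpectralMeasure S F) (hf : Measurable f)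
    {A B : Set ℂ} (hA : MeasurableSet A) (hB : MeasurableSet B) (x : F) :
    m.resolution f A (m.resolution f B x) = m.resolution f (A ∩ B) x :=
  m.toFun_toFun_apply (hf hA) (hf hB) x

variable [PolynormableSpace ℂ F] [T2Space F]

theorem resolution_empty (m : OperatorSpectralMeasure S F) (f : S → ℂ) : m.resolution f ∅ = 0 :=
  m.toFun_empty

theorem HasIntegral.exists_seminorm_resolution_closedBall_le (hm : m.IsEquicontinuous)
    (hU : m.HasIntegral f U) (hξ : ξ ∈ opResolventSet U) {p : Seminorm ℂ F} (hp : Continuous p) :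
    ∃ q : Seminorm ℂ F, Continuous q ∧ ∀ r, 0 ≤ r → ∀ x,
      p (m.resolution f (closedBall ξ r) x) ≤ r * q (m.resolution f (closedBall ξ r) x) := by
  obtain ⟨p', hp', hpp'⟩ := Seminorm.exists_le_comp_of_isInducing
    (f := ((ξ • (1 : F →L[ℂ] F) - U : F →L[ℂ] F) : F →ₗ[ℂ] F)) hp hξ.2.isInducing
  obtain ⟨q, hq, hpq⟩ := hm.exists_seminorm_integral_le hp'
  refine ⟨q, hq, fun r hr x => ?_⟩
  have hD : MeasurableSet (f ⁻¹' closedBall ξ r) := hU.measurable measurableSet_closedBall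
  have hint := ((m.hasIntegral_const ξ).sub hU).mul hm (m.hasIntegral_indicator hD)
  have hidem : m.toFun (f ⁻¹' closedBall ξ r) (m.resolution f (closedBall ξ r) x) =
      m.resolution f (closedBall ξ r) x := by
    rw [resolution, m.toFun_toFun_apply hD hD, Set.inter_self]
  calc p (m.resolution f (closedBall ξ r) x)
      ≤ p' ((ξ • (1 : F →L[ℂ] F) - U) (m.resolution f (closedBall ξ r) x)) := hpp' _
    _ = p' (((ξ • (1 : F →L[ℂ] F) - U) * m.toFun (f ⁻¹' closedBall ξ r))
          (m.resolution f (closedBall ξ r) x)) := by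
        rw [mul_apply_eq_comp, hidem]
    _ ≤ r * q (m.resolution f (closedBall ξ r) x) := by
        refine hpq hint hr (fun s => ?_) _
        by_cases hs : s ∈ f ⁻¹' closedBall ξ r
        · have hdist : ‖ξ - f s‖ ≤ r := dist_eq_norm ξ (f s) ▸ mem_closedBall'.1 hs
          simpa [hs] using hdist
        · simpa [hs] using hr

theorem HasIntegral.exists_seminorm_resolution_closedBall_le_pow (hm : m.IsEquicontinuous)
    (hU : m.HasIntegral f U) (hξ : ξ ∈ opResolventSet U) (k : ℕ) {p : Seminorm ℂ F}
    (hp : Continuous p) :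
    ∃ q : Seminorm ℂ F, Continuous q ∧ ∀ r, 0 ≤ r → ∀ x,
      p (m.resolution f (closedBall ξ r) x) ≤ r ^ k * q x := by
  induction k generalizing p with
  | zero =>
    obtain ⟨q, hq, hpq⟩ := hm p hp
    refine ⟨q, hq, fun r _ x => ?_⟩
    rw [pow_zero, one_mul]
    exact hpq _ (hU.measurable measurableSet_closedBall) x
  | succ k ih =>
    obtain ⟨q, hq, hpq⟩ := hU.exists_seminorm_resolution_closedBall_le hm hξ hp
    obtain ⟨q', hq', hqq'⟩ := ih hq
    refine ⟨q', hq', fun r hr x => (hpq r hr x).trans ?_⟩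
    rw [pow_succ', mul_assoc]
    exact mul_le_mul_of_nonneg_left (hqq' r hr x) hr

theorem HasIntegral.ae_mem_opSpectrum (hm : m.IsEquicontinuous) (hU : m.HasIntegral f U)
    (hν : ∀ A, MeasurableSet A → ν.real A ≤ ‖y (m.resolution f A x)‖) :
    ∀ᵐ z ∂ν, z ∈ opSpectrum U := by
  filter_upwards [ae_not_tendsto_measure_closedBall_div_top volume ν] with ξ hξ
  by_contra hres
  -- Any exponent larger than `2`, the real dimension of `ℂ`, would do.
  obtain ⟨q, -, hq⟩ := hU.exists_seminorm_resolution_closedBall_le_pow hm (not_not.1 hres) 3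
    (p := y.toSeminorm) y.continuous.norm
  refine hξ (tendsto_volume_closedBall_div_top (C := q x) fun r hr => ?_)
  exact (hν _ measurableSet_closedBall).trans ((hq r hr.le x).trans_eq (mul_comm _ _))

theorem exists_strictMono_tendsto_of_hasIntegral_comp (hF : LocallySeqWeaklyCompact F)
    (hm : m.IsEquicontinuous) (hf : Measurable f) {u : ℕ → ℂ → ℂ} {V : ℕ → F →L[ℂ] F}
    (hV : ∀ k, m.HasIntegral (u k ∘ f) (V k)) {K : ℝ} (hu : ∀ k z, ‖u k z‖ ≤ K) (x : F) :
    ∃ φ : ℕ → ℕ, StrictMono φ ∧ ∀ z, m.resolution f {z} x ≠ 0 →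
      ∃ c, Tendsto (fun n => u (φ n) z) atTop (𝓝 c) := by
  have hK : 0 ≤ K := (norm_nonneg _).trans (hu 0 0)
  have hbdd : Bornology.IsVonNBounded ℂ (Set.range fun k => V k x) := by
    rw [(PolynormableSpace.withSeminorms ℂ F).isVonNBounded_iff_seminorm_bounded]
    rintro ⟨p, hp⟩
    obtain ⟨q, -, hpq⟩ := hm.exists_seminorm_integral_le hp
    refine ⟨K * q x + 1, by positivity, ?_⟩
    rintro _ ⟨k, rfl⟩
    exact (hpq (hV k) hK (fun s => hu k (f s)) x).trans_lt (lt_add_one _)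
  obtain ⟨w, φ, hφ, hw⟩ := hF _ hbdd
  refine ⟨φ, hφ, fun z hz => ?_⟩
  obtain ⟨y, hy⟩ : ∃ y : F →L[ℂ] ℂ, y (m.resolution f {z} x) ≠ 0 := by
    by_contra! h
    exact hz (eq_zero_of_forall_dual h)
  have hatom : ∀ k, y (m.resolution f {z} (V k x)) = u k z * y (m.resolution f {z} x) := fun k => by
    have h := (hV k).toFun_mul_eq_smul hm (hf (measurableSet_singleton z))
      fun s hs => congrArg (u k) hs
    exact (congrArg y (DFunLike.congr_fun h x)).trans (map_smul y _ _)
  have hlim := (hw (y.comp (m.resolution f {z}))).div_const (y (m.resolution f {z} x))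
  simp only [ContinuousLinearMap.comp_apply, hatom, mul_div_cancel_right₀ _ hy] at hlim
  exact ⟨_, hlim⟩

theorem exists_strictMono_tendsto_of_forall_norm_le (hF : LocallySeqWeaklyCompact F)
    (hm : m.IsEquicontinuous) (hf : Measurable f) {h : ℕ → ℂ → ℂ} (hh : ∀ k, Measurable (h k))
    {K : ℝ} (hK : ∀ k z, ‖h k z‖ ≤ K) (x : F) :
    ∃ φ : ℕ → ℕ, StrictMono φ ∧ ∀ z, m.resolution f {z} x ≠ 0 →
      ∃ c, Tendsto (fun n => h (φ n) z) atTop (𝓝 c) := by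
  have hb : ∀ k, TotallyBounded (Set.range (h k)) := fun k =>
    (isCompact_closedBall (0 : ℂ) K).totallyBounded.subset <| by
      rintro _ ⟨z, rfl⟩
      simpa using hK k z
  choose u hu using fun k : ℕ =>
    exists_simpleFunc_forall_dist_le (hh k) (hb k) (Nat.one_div_pos_of_nat (α := ℝ) (n := k))
  have huK : ∀ k z, ‖u k z‖ ≤ 1 + K := fun k z => by
    have hclose : ‖u k z - h k z‖ ≤ 1 := by
      rw [← dist_eq_norm, dist_comm]
      exact (hu k z).trans (div_le_one_of_le₀ (by simp) (by positivity))
    linarith [norm_le_norm_sub_add (u k z) (h k z), hK k z]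
  obtain ⟨φ, hφ, hlim⟩ := exists_strictMono_tendsto_of_hasIntegral_comp hF hm hf
    (fun k => m.hasIntegral_simpleFunc ((u k).comp f hf)) huK x
  refine ⟨φ, hφ, fun z hz => (hlim z hz).imp fun c hc => ?_⟩
  refine hc.congr_dist (squeeze_zero (fun _ => dist_nonneg)
    (fun n => (dist_comm _ _).trans_le (hu (φ n) z)) ?_)
  exact tendsto_one_div_add_atTop_nhds_zero_nat.comp hφ.tendsto_atTop

theorem ae_resolution_singleton_eq_zero [TopologicalSpace.SeparableSpace F]
    [NullSingletonClass ν] (hF : LocallySeqWeaklyCompact F) (hm : m.IsEquicontinuous)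
    (hf : Measurable f) : ∀ᵐ z ∂ν, m.resolution f {z} = 0 := by
  obtain ⟨G, hG, hdiv⟩ := exists_measurable_ae_not_exists_tendsto_fourierChar ν
  have hchar : ∀ k : ℕ, Measurable fun z => (𝐞 (-(G z * k)) : ℂ) := fun k =>
    (continuous_subtype_val.comp Real.continuous_fourierChar).measurable.comp
      (hG.mul_const _).neg
  have hvec : ∀ x, ∀ᵐ z ∂ν, m.resolution f {z} x = 0 := fun x => by
    obtain ⟨φ, hφ, hconv⟩ := exists_strictMono_tendsto_of_forall_norm_le hF hm hf hchar
      (fun _ _ => (Circle.norm_coe _).le) x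
    exact (hdiv φ hφ).mono fun z hz => not_not.1 (mt (hconv z) hz)
  have : Nonempty F := ⟨0⟩
  filter_upwards [ae_all_iff.2 fun n => hvec (TopologicalSpace.denseSeq F n)] with z hz
  refine ContinuousLinearMap.coeFn_injective ?_
  exact (TopologicalSpace.denseRange_denseSeq F).equalizer (m.resolution f {z}).continuous
    continuous_const (funext hz)

theorem HasIntegral.measure_eq_zero_of_dominated [TopologicalSpace.SeparableSpace F]
    (hF : LocallySeqWeaklyCompact F) (hm : m.IsEquicontinuous) (hU : m.HasIntegral f U)
    {B : Set ℂ} (hB : MeasurableSet B) (hσ : opSpectrum U ∩ B ⊆ opPointSpectrum U)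
    (hν : ∀ A, MeasurableSet A → ν.real A ≤ ‖y (m.resolution f (A ∩ B) x)‖)
    (hy : ∀ μ ∈ opPointSpectrum U ∩ B, y (m.resolution f {μ} x) = 0) : ν = 0 := by
  have hνB : ∀ᵐ z ∂ν, z ∈ B := by
    have h := hν Bᶜ hB.compl
    rw [Set.compl_inter_self, resolution_empty, zero_apply, map_zero, norm_zero] at h
    exact mem_ae_iff.2 ((measureReal_eq_zero_iff).1 (h.antisymm measureReal_nonneg))
  have hνσ : ∀ᵐ z ∂ν, z ∈ opSpectrum U := by
    refine hU.ae_mem_opSpectrum hm (x := m.resolution f B x) (y := y) fun A hA => ?_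
    rw [m.resolution_resolution hU.measurable hA hB]
    exact hν A hA
  have : NullSingletonClass ν := ⟨fun z => by
    have hz : y (m.resolution f ({z} ∩ B) x) = 0 := by
      by_cases hzB : z ∈ B
      · rw [Set.singleton_inter_of_mem hzB]
        by_cases hzσ : z ∈ opPointSpectrum U
        · exact hy z ⟨hzσ, hzB⟩
        · rw [← hU.resolution_singleton_ne_zero_iff hm, not_not] at hzσ
          rw [hzσ, zero_apply, map_zero]
      · rw [Set.singleton_inter_eq_empty.2 hzB, resolution_empty, zero_apply, map_zero]
    have h := hν {z} (measurableSet_singleton z)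
    rw [hz, norm_zero] at h
    exact (measureReal_eq_zero_iff).1 (h.antisymm measureReal_nonneg)⟩
  refine ae_eq_bot.1 (Filter.eventually_false_iff_eq_bot.1 ?_)
  filter_upwards [hνB, hνσ, ae_resolution_singleton_eq_zero hF hm hU.measurable] with z hzB hzσ hz0
  exact (hU.resolution_singleton_ne_zero_iff hm z).2 (hσ ⟨hzσ, hzB⟩) hz0

theorem HasIntegral.dual_resolution_eq_zero [TopologicalSpace.SeparableSpace F]
    (hF : LocallySeqWeaklyCompact F) (hm : m.IsEquicontinuous) (hU : m.HasIntegral f U)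
    {B : Set ℂ} (hB : MeasurableSet B) (hσ : opSpectrum U ∩ B ⊆ opPointSpectrum U)
    (hy : ∀ μ ∈ opPointSpectrum U ∩ B, y (m.resolution f {μ} x) = 0) :
    y (m.resolution f B x) = 0 := by
  have hf := hU.measurable
  set κ : ComplexMeasure ℂ := ((m.toComplexMeasure x y).map f).restrict B
  have hκ : ∀ A, MeasurableSet A → κ A = y (m.resolution f (A ∩ B) x) := fun A hA => by
    rw [VectorMeasure.restrict_apply _ hB hA, VectorMeasure.map_apply _ hf (hA.inter hB)]
    exact m.toComplexMeasure_apply x y (hf (hA.inter hB))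
  have hκ0 : κ = 0 := complexMeasure_eq_zero_of_forall_dominated fun P ν _ hP hν => by
    refine hU.measure_eq_zero_of_dominated hF hm hB hσ (x := x) (y := y.comp (m.resolution f P))
      (fun A hA => ?_) fun μ hμ => ?_
    · rw [ContinuousLinearMap.comp_apply, m.resolution_resolution hf hP (hA.inter hB),
        ← Set.inter_assoc, ← hκ _ (hP.inter hA)]
      exact hν A hA
    · rw [ContinuousLinearMap.comp_apply,
        m.resolution_resolution hf hP (measurableSet_singleton μ)]
      by_cases hμP : μ ∈ P
      · rw [Set.inter_singleton_of_mem hμP, hy μ hμ]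
      · rw [Set.inter_singleton_eq_empty.2 hμP, resolution_empty, zero_apply, map_zero]
  simpa [hκ0] using (hκ Set.univ .univ).symm

end OperatorSpectralMeasure

section RingPowers

theorem smul_mul_one_sub_pow {R A : Type*} [CommSemiring R] [Ring A] [Algebra R A] {a e : A}
    (hcomm : Commute a e) (he : IsIdempotentElem e) (c : R) {k : ℕ} (hk : k ≠ 0) :
    (c • (a * (1 - e))) ^ k = c ^ k • (a ^ k * (1 - e)) := by
  rw [smul_pow, ((Commute.one_right a).sub_right hcomm).mul_pow, he.one_sub.pow_eq hk]

end RingPowers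

section Averages

variable {F : Type*} [AddCommGroup F] [Module ℂ F] [TopologicalSpace F]
  [IsTopologicalAddGroup F] [ContinuousSMul ℂ F]

theorem opAverage_apply_sub_inv_smul (T : F →L[ℂ] F) (x : F) {n : ℕ} (hn : 0 < n) :
    opAverage n T x - (n : ℂ)⁻¹ • x = (n : ℂ)⁻¹ • ∑ k ∈ Finset.Ico 1 n, (T ^ k) x := by
  rw [opAverage_apply, ← smul_sub, Finset.sum_range_eq_add_Ico _ hn, pow_zero, one_apply_eq_self,
    add_sub_cancel_left]

theorem tendsto_sum_Ico_of_tendsto_opAverage {T : F →L[ℂ] F} {x z : F}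
    (h : Tendsto (fun n => opAverage n T x) atTop (𝓝 z)) :
    Tendsto (fun n : ℕ => (n : ℂ)⁻¹ • ∑ k ∈ Finset.Ico 1 n, (T ^ k) x) atTop (𝓝 z) := by
  have hlim : Tendsto (fun n : ℕ => opAverage n T x - (n : ℂ)⁻¹ • x) atTop (𝓝 z) := by
    simpa using h.sub ((tendsto_inv_atTop_nhds_zero_nat (𝕜 := ℂ)).smul_const x)
  exact hlim.congr' ((eventually_gt_atTop 0).mono fun n hn => opAverage_apply_sub_inv_smul T x hn)

end Averages

namespace OperatorSpectralMeasure

variable {F : Type*} [AddCommGroup F] [Module ℂ F] [TopologicalSpace F]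
  [IsTopologicalAddGroup F] [ContinuousSMul ℂ F] {S : Type*} [MeasurableSpace S]
  {m : OperatorSpectralMeasure S F} {f : S → ℂ} {U : F →L[ℂ] F} {A B : Set ℂ} {lam : ℂ} {x : F}

theorem measurableSet_setOf_lt_norm (r : ℝ) : MeasurableSet {z : ℂ | r < ‖z‖} :=
  measurableSet_lt measurable_const measurable_norm

theorem isIdempotentElem_resolution (m : OperatorSpectralMeasure S F) (hf : Measurable f)
    (hB : MeasurableSet B) : IsIdempotentElem (m.resolution f B) := by
  rw [IsIdempotentElem, resolution, ← m.inter_eq_mul _ _ (hf hB) (hf hB), Set.inter_self]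

variable [PolynormableSpace ℂ F] [T2Space F]

theorem resolution_compl (m : OperatorSpectralMeasure S F) (hf : Measurable f)
    (hB : MeasurableSet B) : m.resolution f Bᶜ = 1 - m.resolution f B := by
  rw [resolution, Set.preimage_compl, m.toFun_compl (hf hB), resolution]

theorem resolution_finset (m : OperatorSpectralMeasure S F) (hf : Measurable f) (t : Finset ℂ) :
    m.resolution f t = ∑ μ ∈ t, m.resolution f {μ} := by
  unfold resolution
  rw [← m.toFun_biUnion_finset (fun μ _ => hf (measurableSet_singleton μ))]
  · congr 1
    ext s
    simp
  · intro μ _ μ' _ h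
    exact Disjoint.preimage f (by simpa using h)

theorem resolution_diff (m : OperatorSpectralMeasure S F) (hf : Measurable f)
    (hA : MeasurableSet A) (hB : MeasurableSet B) (h : A ⊆ B) :
    m.resolution f (B \ A) = m.resolution f B - m.resolution f A := by
  have hunion := m.toFun_union (hf hA) (hf (hB.diff hA))
    (Disjoint.preimage f disjoint_sdiff_self_right)
  rw [← Set.preimage_union, Set.union_sdiff_cancel h] at hunion
  exact (sub_eq_of_eq_add' hunion).symm

theorem eventually_resolution_diff_eq_zero_of_mem_span (m : OperatorSpectralMeasure S F)
    (hf : Measurable f) (hB : MeasurableSet B) {v : F}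
    (hv : v ∈ Submodule.span ℂ (Set.range fun μ : A => m.resolution f {(μ : ℂ)} x)) :
    ∀ᶠ t : Finset A in atTop, m.resolution f (B \ t.map (.subtype _)) v = 0 := by
  induction hv using Submodule.span_induction with
  | mem v hv =>
    obtain ⟨μ, rfl⟩ := hv
    filter_upwards [eventually_ge_atTop {μ}] with t ht
    have hμt : (μ : ℂ) ∈ t.map (.subtype _) :=
      Finset.mem_map_of_mem _ (ht (Finset.mem_singleton_self μ))
    rw [m.resolution_resolution hf (hB.diff (Finset.measurableSet _)) (measurableSet_singleton _),
      Set.inter_singleton_eq_empty.2 fun h => h.2 hμt, resolution_empty, zero_apply]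
  | zero => exact .of_forall fun t => map_zero _
  | add v w _ _ hv hw => filter_upwards [hv, hw] with t hv hw; rw [map_add, hv, hw, add_zero]
  | smul c v _ hv => filter_upwards [hv] with t hv; rw [map_smul, hv, smul_zero]

theorem hasSum_resolution_singleton_of_mem_closure_span (hm : m.IsEquicontinuous)
    (hf : Measurable f) (hB : MeasurableSet B) (hAB : A ⊆ B)
    (hx : m.resolution f B x ∈
      closure (Submodule.span ℂ (Set.range fun μ : A => m.resolution f {(μ : ℂ)} x) : Set F)) :
    HasSum (fun μ : A => m.resolution f {(μ : ℂ)} x) (m.resolution f B x) := by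
  rw [HasSum, SummationFilter.unconditional_filter]
  refine tendsto_nhds_iff_forall_seminorm.2 fun p hp => Metric.tendsto_nhds.2 fun ε hε => ?_
  obtain ⟨q, hq, hpq⟩ := hm p hp
  obtain ⟨v, hv, hqv⟩ := exists_seminorm_sub_lt_of_mem_closure hx hq hε
  filter_upwards [m.eventually_resolution_diff_eq_zero_of_mem_span hf hB hv] with t ht
  set t' : Finset ℂ := t.map (.subtype _) with ht'
  have hsub : (t' : Set ℂ) ⊆ B := fun z hz => by
    obtain ⟨μ, -, rfl⟩ := Finset.mem_map.1 hz
    exact hAB μ.2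
  have hmeas : MeasurableSet (B \ t') := hB.diff t'.measurableSet
  have hremainder : m.resolution f B x - ∑ μ ∈ t, m.resolution f {(μ : ℂ)} x =
      m.resolution f (B \ t') (m.resolution f B x - v) := by
    rw [map_sub, ht, sub_zero, m.resolution_resolution hf hmeas hB,
      Set.inter_eq_left.2 Set.sdiff_subset, m.resolution_diff hf t'.measurableSet hB hsub,
      m.resolution_finset hf, ht', Finset.sum_map, sub_apply, sum_apply]
    rfl
  rw [Real.dist_eq, sub_zero, abs_of_nonneg (apply_nonneg _ _), map_sub_rev, hremainder]
  exact (hpq _ (hf hmeas) _).trans_lt hqv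

section Atomic

variable [TopologicalSpace.SeparableSpace F]

theorem HasIntegral.hasSum_resolution_largerEigenvalues (hF : LocallySeqWeaklyCompact F)
    (hm : m.IsEquicontinuous) (hU : m.HasIntegral f U)
    (hσ : opSpectrum U ∩ {z | ‖lam‖ < ‖z‖} ⊆ opPointSpectrum U) (x : F) :
    HasSum (fun ν : largerEigenvalues U lam => m.resolution f {(ν : ℂ)} x)
      (m.resolution f {z | ‖lam‖ < ‖z‖} x) := by
  have hB := measurableSet_setOf_lt_norm ‖lam‖
  refine hasSum_resolution_singleton_of_mem_closure_span hm hU.measurable hB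
    (fun z hz => hz.2) (mem_closure_of_forall_dual fun y hy => ?_)
  exact hU.dual_resolution_eq_zero hF hm hB hσ fun μ hμ =>
    hy _ (Submodule.subset_span ⟨⟨μ, hμ⟩, rfl⟩)

theorem HasIntegral.resolution_eq_zero_of_disjoint (hF : LocallySeqWeaklyCompact F)
    (hm : m.IsEquicontinuous) (hU : m.HasIntegral f U) (hB : MeasurableSet B)
    (h : Disjoint (opSpectrum U) B) : m.resolution f B = 0 := by
  ext x
  refine eq_zero_of_forall_dual fun y => hU.dual_resolution_eq_zero hF hm hB ?_ fun μ hμ => ?_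
  · simp [h.inter_eq]
  · exact absurd hμ.2 (Set.disjoint_left.1 h hμ.1.1)

end Atomic

theorem HasIntegral.hasIntegral_inv_smul_mul_one_sub (hm : m.IsEquicontinuous)
    (hU : m.HasIntegral f U) (hB : MeasurableSet B) (lam : ℂ) :
    m.HasIntegral (lam⁻¹ • (f * (f ⁻¹' Bᶜ).indicator 1))
      (lam⁻¹ • (U * (1 - m.resolution f B))) := by
  rw [← m.resolution_compl hU.measurable hB]
  exact (hU.mul hm (m.hasIntegral_indicator (hU.measurable hB.compl))).smul lam⁻¹

theorem HasIntegral.tendsto_opAverage_inv_smul_mul_one_sub (hm : m.IsEquicontinuous)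
    (hU : m.HasIntegral f U) (hlam0 : lam ≠ 0) (x : F) :
    Tendsto (fun n => opAverage n (lam⁻¹ • (U * (1 - m.resolution f {z | ‖lam‖ < ‖z‖}))) x)
      atTop (𝓝 (m.resolution f {lam} x)) := by
  have hint := hU.hasIntegral_inv_smul_mul_one_sub hm (measurableSet_setOf_lt_norm ‖lam‖) lam
  set g := lam⁻¹ • (f * (f ⁻¹' {z | ‖lam‖ < ‖z‖}ᶜ).indicator 1)
  have hg_small : ∀ s, ‖f s‖ ≤ ‖lam‖ → g s = lam⁻¹ * f s := fun s hs => by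
    simp [g, hs]
  have hg_large : ∀ s, ‖lam‖ < ‖f s‖ → g s = 0 := fun s hs => by
    simp [g, hs]
  have hg_le : ∀ s, ‖g s‖ ≤ 1 := fun s => by
    obtain hs | hs := le_or_gt ‖f s‖ ‖lam‖
    · rw [hg_small s hs, norm_mul, norm_inv]
      exact inv_mul_le_one_of_le₀ hs (norm_nonneg _)
    · simp [hg_large s hs]
  have hpeak : g ⁻¹' {1} = f ⁻¹' {lam} := by
    ext s
    simp only [Set.mem_preimage, Set.mem_singleton_iff]
    obtain hs | hs := le_or_gt ‖f s‖ ‖lam‖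
    · rw [hg_small s hs, inv_mul_eq_one₀ hlam0, eq_comm]
    · rw [hg_large s hs]
      exact iff_of_false zero_ne_one fun h => (h ▸ hs).false
  simpa only [hpeak] using! hint.tendsto_opAverage hm hg_le x

theorem HasIntegral.inv_smul_mul_one_sub_pow_apply (hm : m.IsEquicontinuous)
    (hU : m.HasIntegral f U) (hB : MeasurableSet B) (lam : ℂ) {k : ℕ} (hk : k ≠ 0) (x : F) :
    ((lam⁻¹ • (U * (1 - m.resolution f B))) ^ k) x =
      lam⁻¹ ^ k • (U ^ k) ((1 - m.resolution f B) x) := by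
  have hcomm : Commute U (m.resolution f B) :=
    hU.commute hm (m.hasIntegral_indicator (hU.measurable hB))
  exact DFunLike.congr_fun (smul_mul_one_sub_pow hcomm
    (m.isIdempotentElem_resolution hU.measurable hB) lam⁻¹ hk) x

theorem HasIntegral.tendsto_inv_smul_sum_Ico (hm : m.IsEquicontinuous)
    (hU : m.HasIntegral f U) (hlam0 : lam ≠ 0) (x : F) :
    Tendsto (fun n : ℕ => (n : ℂ)⁻¹ • ∑ k ∈ Finset.Ico 1 n,
      lam⁻¹ ^ k • (U ^ k) ((1 - m.resolution f {z | ‖lam‖ < ‖z‖}) x)) atTop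
      (𝓝 (m.resolution f {lam} x)) := by
  refine (tendsto_sum_Ico_of_tendsto_opAverage
    (hU.tendsto_opAverage_inv_smul_mul_one_sub hm hlam0 x)).congr fun n => ?_
  refine congrArg _ (Finset.sum_congr rfl fun k hk => ?_)
  exact hU.inv_smul_mul_one_sub_pow_apply hm (measurableSet_setOf_lt_norm _) lam
    (Nat.one_le_iff_ne_zero.1 (Finset.mem_Ico.1 hk).1) x

theorem HasIntegral.tendsto_opAverage_inv_smul (hm : m.IsEquicontinuous)
    (hU : m.HasIntegral f U) (hlam0 : lam ≠ 0)
    (hx : m.resolution f {z | ‖lam‖ < ‖z‖} x = 0) :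
    Tendsto (fun n => opAverage n (lam⁻¹ • U) x) atTop (𝓝 (m.resolution f {lam} x)) := by
  refine (hU.tendsto_opAverage_inv_smul_mul_one_sub hm hlam0 x).congr fun n => ?_
  rw [opAverage_apply, opAverage_apply]
  refine congrArg _ (Finset.sum_congr rfl fun k _ => ?_)
  obtain rfl | hk := eq_or_ne k 0
  · rfl
  · rw [hU.inv_smul_mul_one_sub_pow_apply hm (measurableSet_setOf_lt_norm _) lam hk, sub_apply, hx,
      sub_zero, smul_pow]
    rfl

variable [TopologicalSpace.SeparableSpace F]

theorem HasIntegral.tendsto_opAverage_inv_smul_resolution_compl (hF : LocallySeqWeaklyCompact F)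
    (hm : m.IsEquicontinuous) (hU : m.HasIntegral f U) (hlam0 : lam ≠ 0)
    (hσ : opSpectrum U ∩ {z | ‖lam‖ < ‖z‖} ⊆ opPointSpectrum U) (hA : MeasurableSet A)
    (hlamA : lam ∉ A) (hlarger : largerEigenvalues U lam ⊆ A) (x : F) :
    Tendsto (fun n => opAverage n (lam⁻¹ • U) (m.resolution f Aᶜ x)) atTop
      (𝓝 (m.resolution f {lam} x)) := by
  have hf := hU.measurable
  have hB := measurableSet_setOf_lt_norm ‖lam‖
  have hsupp : Disjoint (opSpectrum U) ({z | ‖lam‖ < ‖z‖} ∩ Aᶜ) :=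
    Set.disjoint_left.2 fun z hz hzB => hzB.2 (hlarger ⟨hσ ⟨hz, hzB.1⟩, hzB.1⟩)
  have hlarge : m.resolution f {z | ‖lam‖ < ‖z‖} (m.resolution f Aᶜ x) = 0 := by
    rw [m.resolution_resolution hf hB hA.compl,
      hU.resolution_eq_zero_of_disjoint hF hm (hB.inter hA.compl) hsupp, zero_apply]
  have hlam : m.resolution f {lam} (m.resolution f Aᶜ x) = m.resolution f {lam} x := by
    rw [m.resolution_resolution hf (measurableSet_singleton _) hA.compl,
      Set.singleton_inter_of_mem (Set.mem_compl hlamA)]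
  exact hlam ▸ hU.tendsto_opAverage_inv_smul hm hlam0 hlarge

theorem HasIntegral.exists_tendsto_opAverage_recursion (hF : LocallySeqWeaklyCompact F)
    (hm : m.IsEquicontinuous) (hU : m.HasIntegral f U) (hlam0 : lam ≠ 0)
    (hσ : opSpectrum U ∩ {z | ‖lam‖ < ‖z‖} ⊆ opPointSpectrum U) {N : ℕ} {ν : Fin N → ℂ}
    (hν : Function.Injective ν) (hrange : Set.range ν = largerEigenvalues U lam)
    (hanti : Antitone fun j => ‖ν j‖) (x : F) :
    ∃ ρ : Fin (N + 1) → F, ρ 0 = x ∧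
      (∀ j : Fin N,
        Tendsto (fun n => opAverage n ((ν j)⁻¹ • U) (ρ j.castSucc)) atTop
          (𝓝 (m.resolution f {ν j} x)) ∧
        ρ j.succ = ρ j.castSucc - m.resolution f {ν j} x) ∧
      Tendsto (fun n => opAverage n (lam⁻¹ • U) (ρ (Fin.last N))) atTop
        (𝓝 (m.resolution f {lam} x)) := by
  have hmem : ∀ j, ν j ∈ largerEigenvalues U lam := fun j => hrange ▸ Set.mem_range_self j
  have hmeas : ∀ j, MeasurableSet (ν '' {i | i.castSucc < j}) := fun j =>
    ((Set.toFinite _).image ν).measurableSet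
  refine ⟨fun j => m.resolution f (ν '' {i | i.castSucc < j})ᶜ x, ?_, fun j => ⟨?_, ?_⟩, ?_⟩
  · simp [resolution, m.univ_eq_one]
  · refine hU.tendsto_opAverage_inv_smul_resolution_compl hF hm
      (norm_pos_iff.1 ((norm_nonneg _).trans_lt (hmem j).2))
      (fun z hz => hσ ⟨hz.1, (hmem j).2.trans hz.2⟩) (hmeas _) ?_ (fun z hz => ?_) x
    · simp [hν.eq_iff]
    · obtain ⟨i, rfl⟩ : z ∈ Set.range ν := hrange ▸ ⟨hz.1, (hmem j).2.trans hz.2⟩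
      exact ⟨i, lt_of_not_ge fun hji =>
        (hanti (Fin.castSucc_le_castSucc_iff.1 hji)).not_gt hz.2, rfl⟩
  · have hsucc : (ν '' {i | i.castSucc < j.succ})ᶜ =
        (ν '' {i | i.castSucc < j.castSucc})ᶜ \ {ν j} := by
      have hinsert :
          {i : Fin N | i.castSucc < j.succ} = insert j {i | i.castSucc < j.castSucc} := by
        ext i
        simp [Fin.castSucc_lt_succ_iff, le_iff_eq_or_lt]
      rw [hinsert, Set.image_insert_eq, Set.insert_eq, Set.union_comm, Set.compl_union,
        Set.sdiff_eq]
    beta_reduce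
    rw [hsucc, m.resolution_diff hU.measurable (measurableSet_singleton _) (hmeas _).compl
      (by simp [hν.eq_iff]), sub_apply]
  · refine hU.tendsto_opAverage_inv_smul_resolution_compl hF hm hlam0 hσ (hmeas _) ?_ ?_ x
    · rintro ⟨i, -, rfl⟩
      exact (hmem i).2.false
    · simp [← hrange, Fin.castSucc_lt_last]

end OperatorSpectralMeasure

theorem mainTheorem1_general {F : Type*} [AddCommGroup F] [Module ℂ F] [TopologicalSpace F]
    [IsTopologicalAddGroup F] [ContinuousSMul ℂ F] [PolynormableSpace ℂ F] [T2Space F]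
    [TopologicalSpace.SeparableSpace F] (hF : LocallySeqWeaklyCompact F)
    {S : Type*} [MeasurableSpace S] {m : OperatorSpectralMeasure S F} (hm : m.IsEquicontinuous)
    {f : S → ℂ} {U : F →L[ℂ] F} (hU : m.HasIntegral f U) {lam : ℂ} (hlam0 : lam ≠ 0)
    (hσ : opSpectrum U ∩ {z | ‖lam‖ < ‖z‖} ⊆ opPointSpectrum U) :
    Set.range (m.resolution f {lam}) = {ψ : F | U ψ = lam • ψ} ∧
    (∃ Q : F →L[ℂ] F,
      (∀ ψ : F, HasSum (fun ν : largerEigenvalues U lam => m.resolution f {(ν : ℂ)} ψ) (Q ψ)) ∧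
      (∀ ψ : F, Tendsto (fun n : ℕ => opAverage n (lam⁻¹ • (U * (1 - Q))) ψ) atTop
        (𝓝 (m.resolution f {lam} ψ))) ∧
      (∀ ψ : F, Tendsto
        (fun n : ℕ => (n : ℂ)⁻¹ • ∑ k ∈ Finset.Ico 1 n, (lam⁻¹) ^ k • (U ^ k) ((1 - Q) ψ)) atTop
        (𝓝 (m.resolution f {lam} ψ)))) ∧
    (∀ (N : ℕ) (ν : Fin N → ℂ), Function.Injective ν → Set.range ν = largerEigenvalues U lam →
      Antitone (fun j => ‖ν j‖) → ∀ ψ : F, ∃ ρ : Fin (N + 1) → F, ρ 0 = ψ ∧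
        (∀ j : Fin N,
          Tendsto (fun n : ℕ => opAverage n ((ν j)⁻¹ • U) (ρ j.castSucc)) atTop
            (𝓝 (m.resolution f {ν j} ψ)) ∧
          ρ j.succ = ρ j.castSucc - m.resolution f {ν j} ψ) ∧
        Tendsto (fun n : ℕ => opAverage n (lam⁻¹ • U) (ρ (Fin.last N))) atTop
          (𝓝 (m.resolution f {lam} ψ))) :=
  ⟨hU.range_resolution_singleton hm lam,
    ⟨m.resolution f {z | ‖lam‖ < ‖z‖}, hU.hasSum_resolution_largerEigenvalues hF hm hσ,
      hU.tendsto_opAverage_inv_smul_mul_one_sub hm hlam0, hU.tendsto_inv_smul_sum_Ico hm hlam0⟩,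
    fun _ _ hν hrange hanti => hU.exists_tendsto_opAverage_recursion hF hm hlam0 hσ hν hrange hanti⟩

theorem mainTheorem1 {F : Type*} [AddCommGroup F] [Module ℂ F] [TopologicalSpace F]
    [IsTopologicalAddGroup F] [ContinuousSMul ℂ F] [PolynormableSpace ℂ F] [T2Space F]
    [TopologicalSpace.SeparableSpace F] (hF : LocallySeqWeaklyCompact F)
    {S : Type*} [MeasurableSpace S] (m : OperatorSpectralMeasure S F) (hm : m.IsEquicontinuous)
    (f : S → ℂ) (hf : Measurable f) (hfb : ∃ C : ℝ, ∀ s, ‖f s‖ ≤ C)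
    (U : F →L[ℂ] F) (hU : m.HasIntegral f U)
    (R : ℝ) (hR : IsDominatingRadius U R) (hcirc : PointSpectrumOnIsolatedCircles f U)
    (lam : ℂ) (hlam : lam ∈ opPointSpectrum U) (hlamR : R ≤ ‖lam‖) :
    -- `E({lam})` projects onto the eigenspace of `lam`
    Set.range (m.resolution f {lam}) = {ψ : F | U ψ = lam • ψ} ∧
    -- `Q` is the strongly convergent sum of the projections onto the larger eigenspaces
    (∃ Q : F →L[ℂ] F,
      (∀ ψ : F, HasSum (fun ν : largerEigenvalues U lam => m.resolution f {(ν : ℂ)} ψ) (Q ψ)) ∧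
      (∀ ψ : F, Tendsto (fun n : ℕ => opAverage n (lam⁻¹ • (U * (1 - Q))) ψ) atTop
        (𝓝 (m.resolution f {lam} ψ))) ∧
      (∀ ψ : F, Tendsto
        (fun n : ℕ => (n : ℂ)⁻¹ • ∑ k ∈ Finset.Ico 1 n, (lam⁻¹) ^ k • (U ^ k) ((1 - Q) ψ)) atTop
        (𝓝 (m.resolution f {lam} ψ)))) ∧
    -- the finite recursion, in any order of nonincreasing modulus
    (∀ (N : ℕ) (ν : Fin N → ℂ), Function.Injective ν → Set.range ν = largerEigenvalues U lam →
      Antitone (fun j => ‖ν j‖) → ∀ ψ : F, ∃ ρ : Fin (N + 1) → F, ρ 0 = ψ ∧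
        (∀ j : Fin N,
          Tendsto (fun n : ℕ => opAverage n ((ν j)⁻¹ • U) (ρ j.castSucc)) atTop
            (𝓝 (m.resolution f {ν j} ψ)) ∧
          ρ j.succ = ρ j.castSucc - m.resolution f {ν j} ψ) ∧
        Tendsto (fun n : ℕ => opAverage n (lam⁻¹ • U) (ρ (Fin.last N))) atTop
          (𝓝 (m.resolution f {lam} ψ))) :=
  mainTheorem1_general hF hm hU (norm_pos_iff.1 (hR.pos.trans_le hlamR)) fun z hz =>
    hR.eigenvalues ‖z‖ (hlamR.trans_lt hz.2) ⟨hz.1, by simp⟩
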